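/- Let $N\ge 3$, let $K$ be the field $\mathbb{C}(q^{1/2})$ or any extension field of it, and put $i'=N+1-i$ and $\xi=q^{2-N}$. Let $(\bar 1,\dots,\bar N)=(n-\tfrac12,\dots,\tfrac32,\tfrac12,0,-\tfrac12,-\tfrac32,\dots,-n+\tfrac12)$ if $N=2n+1$ and $(\bar 1,\dots,\bar N)=(n-1,\dots,1,0,0,-1,\dots,-n+1)$ if $N=2n$. With the matrix units $e_{ij}\in\mathrm{End}\,K^N$ put $$P=\sum_{i,j}e_{ij}\otimes e_{ji},\qquad Q=\sum_{i,j}q^{\bar\imath-\bar\jmath}e_{i'j'}\otimes e_{ij},$$ $$R=q\sum_{i\ne i'}e_{ii}\otimes e_{ii}+\sum_{i=i'}e_{ii}\otimes e_{ii}+\sum_{i\ne j,j'}e_{ii}\otimes e_{jj}+q^{-1}\sum_{i\ne i'}e_{ii}\otimes e_{i'i'}+(q-q^{-1})\sum_{i<j}e_{ij}\otimes e_{ji}-(q-q^{-1})\sum_{i>j}q^{\bar\imath-\bar\jmath}e_{i'j'}\otimes e_{ij}.$$ Let $f(u)\in 1+uK[[u]]$ be the unique series with $f(u)f(u\xi)=\big((1-uq^{-2})(1-uq^{2})(1-u\xi)(1-u\xi^{-1})\big)^{-1}$,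 and set $$R(u)=f(u)\big(q^{-1}(u-1)(u-\xi)R-(q^{-2}-1)(u-\xi)P+(q^{-2}-1)(u-1)\xi Q\big),$$ $$\overline R(u)=\frac{u-1}{uq-q^{-1}}R+\frac{q-q^{-1}}{uq-q^{-1}}P-\frac{(q-q^{-1})(u-1)\xi}{(uq-q^{-1})(u-\xi)}Q,$$ both regarded as power series in $u$. Let $U(R)$ be the unital associative $K$-algebra generated by an invertible central element $q^{c/2}$ and elements $l^{\pm}_{ij}[\mp m]$ ($1\le i,j\le N$, $m\ge 0$), subject to $l^+_{ij}[0]=l^-_{ji}[0]=0$ for $i>j$, to $l^+_{ii}[0]\,l^-_{ii}[0]=l^-_{ii}[0]\,l^+_{ii}[0]=1$, and to $$R(u/v)L_1^{\pm}(u)L_2^{\pm}(v)=L_2^{\pm}(v)L_1^{\pm}(u)R(u/v),\qquad R(uq^{c}/v)L_1^{+}(u)L_2^{-}(v)=L_2^{-}(v)L_1^{+}(u)R(uq^{-c}/v),$$ where $L^{\pm}(u)=\sum_{i,j}l^{\pm}_{ij}(u)\otimes e_{ij}$, $l^{\pm}_{ij}(u)=\sum_{m\ge0}l^{\pm}_{ij}[\mp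 m]u^{\pm m}$, and the subscripts $1,2$ indicate the copy of $\mathrm{End}\,K^N$. Let $U(\overline R)$ be the algebra defined in the same way with $\overline R(u)$ in place of $R(u)$, and write $\mathcal L^{\pm}(u)$ for its generator matrices. Let $D=\mathrm{diag}[q^{\bar 1},\dots,q^{\bar N}]$ and let $\mathrm t$ be the matrix transposition with $e_{ij}^{\mathrm t}=e_{j'i'}$. Then there are power series $z^{\pm}(u)$ in $u^{\pm1}$ with coefficients in $U(R)$, and power series $\mathfrak z^{\pm}(u)$ in $u^{\pm1}$ with coefficients in $U(\overline R)$, such that $$D L^{\pm}(u\xi)^{\mathrm t}D^{-1}L^{\pm}(u)=L^{\pm}(u)DL^{\pm}(u\xi)^{\mathrm t}D^{-1}=z^{\pm}(u)\,1,$$ $$D\mathcal L^{\pm}(u\xi)^{\mathrm t}D^{-1}\mathcal L^{\pm}(u)=\mathcal L^{\pm}(u)D\mathcal L^{\pm}(u\xi)^{\mathrm t}D^{-1}=\mathfrak z^{\pm}(u)\,1.$$ Moreover, all coefficients of $z^{+}(u)$ and $z^{-}(u)$ lie in the center of $U(R)$. -/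

import Mathlib

open scoped Kronecker PowerSeries

noncomputable section

namespace QAffineBD

/-! ### The `R`-matrices

`K` is the base field, `s` stands for `q^{1/2}`, so `q = s ^ 2`. Indices `1, …, N` are modelled
by `Fin N` (shifted by one), so that `i' = N + 1 - i` is `Fin.rev i`. -/

/-- The parameter `q`. -/
def q {K : Type*} [Field K] (s : K) : K := s ^ 2

/-- The parameter `ξ = q ^ (2 - N)`. -/
def xi {K : Type*} [Field K] (s : K) (N : ℕ) : K := q s ^ ((2 : ℤ) - N)

/-- Twice the barred symbol `i ↦ ī`. With `i` counted from one, `2 ī = N - 2 i` in the first half,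
`0` at the middle index (`N` odd), and `2 ī = N - 2 i + 2` in the second half, so that the list
`(1̄, …, N̄)` is `(n - 1/2, …, 1/2, 0, -1/2, …, -n + 1/2)` for `N = 2 n + 1` and
`(n - 1, …, 1, 0, 0, -1, …, -n + 1)` for `N = 2 n`. -/
def bar2 {N : ℕ} (i : Fin N) : ℤ :=
  if 2 * ((i : ℤ) + 1) < N + 1 then N - 2 * ((i : ℤ) + 1)
  else if 2 * ((i : ℤ) + 1) = N + 1 then 0
  else N - 2 * ((i : ℤ) + 1) + 2

/-- `q ^ (ī - j̄)`. -/
def qbar {K : Type*} [Field K] (s : K) {N : ℕ} (i j : Fin N) : K := s ^ (bar2 i - bar2 j)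

/-- The matrix unit `e_{ij}`. -/
def e {K : Type*} [Field K] {N : ℕ} (i j : Fin N) : Matrix (Fin N) (Fin N) K :=
  Matrix.single i j 1

/-- `P = ∑ e_{ij} ⊗ e_{ji}`. -/
def P (K : Type*) [Field K] (N : ℕ) : Matrix (Fin N × Fin N) (Fin N × Fin N) K :=
  ∑ i : Fin N, ∑ j : Fin N, e i j ⊗ₖ e j i

/-- `Q = ∑ q^{ī - j̄} e_{i'j'} ⊗ e_{ij}`. -/
def Q {K : Type*} [Field K] (s : K) (N : ℕ) : Matrix (Fin N × Fin N) (Fin N × Fin N) K :=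
  ∑ i : Fin N, ∑ j : Fin N, qbar s i j • (e i.rev j.rev ⊗ₖ e i j)

/-- The constant `R`-matrix `R`. The second sum consists of the single term
`e_{n+1,n+1} ⊗ e_{n+1,n+1}` for `N = 2 n + 1`, and is empty for even `N`. -/
def R {K : Type*} [Field K] (s : K) (N : ℕ) : Matrix (Fin N × Fin N) (Fin N × Fin N) K :=
  q s • (∑ i : Fin N, if i ≠ i.rev then e i i ⊗ₖ e i i else 0)
  + (∑ i : Fin N, if i = i.rev then e i i ⊗ₖ e i i else 0)
  + (∑ i : Fin N, ∑ j : Fin N, if i ≠ j ∧ i ≠ j.rev then e i i ⊗ₖ e j j else 0)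
  + (q s)⁻¹ • (∑ i : Fin N, if i ≠ i.rev then e i i ⊗ₖ e i.rev i.rev else 0)
  + (q s - (q s)⁻¹) • (∑ i : Fin N, ∑ j : Fin N, if i < j then e i j ⊗ₖ e j i else 0)
  - (q s - (q s)⁻¹) • (∑ i : Fin N, ∑ j : Fin N,
      if j < i then qbar s i j • (e i.rev j.rev ⊗ₖ e i j) else 0)

/-- The power series `1 / ((1 - u q⁻²) (1 - u q²) (1 - u ξ) (1 - u ξ⁻¹))`. -/
def fRHS {K : Type*} [Field K] (s : K) (N : ℕ) : K⟦X⟧ :=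
  ((1 - PowerSeries.C ((q s)⁻¹ ^ 2) * PowerSeries.X) * (1 - PowerSeries.C (q s ^ 2) * PowerSeries.X)
    * (1 - PowerSeries.C (xi s N) * PowerSeries.X)
    * (1 - PowerSeries.C (xi s N)⁻¹ * PowerSeries.X))⁻¹

/-- The coefficients of `f(u)`, found recursively from the relation in `f_mul_rescale`. -/
def fCoeff {K : Type*} [Field K] (s : K) (N : ℕ) : ℕ → K
  | 0 => 1
  | k + 1 => (PowerSeries.coeff (k + 1) (fRHS s N)
      - ∑ j : Fin k, fCoeff s N (j + 1) * (fCoeff s N (k - j) * xi s N ^ (k - (j : ℕ))))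
      / (1 + xi s N ^ (k + 1))
  decreasing_by all_goals omega

/-- The power series `f(u)`. -/
def f {K : Type*} [Field K] (s : K) (N : ℕ) : K⟦X⟧ := PowerSeries.mk (fCoeff s N)

/-- `f(u)` has constant term one. -/
theorem constantCoeff_f {K : Type*} [Field K] (s : K) (N : ℕ) :
    PowerSeries.constantCoeff (f s N) = 1 := by
  simp [f, fCoeff]

/-- The defining relation of `f(u)`:
`f(u) f(u ξ) = 1 / ((1 - u q⁻²) (1 - u q²) (1 - u ξ) (1 - u ξ⁻¹))`. -/
theorem f_mul_rescale {K : Type*} [Field K] (s : K) (N : ℕ)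
    (h : ∀ k : ℕ, 0 < k → 1 + xi s N ^ k ≠ 0) :
    f s N * PowerSeries.rescale (xi s N) (f s N) = fRHS s N := by
  ext n
  rw [PowerSeries.coeff_mul, Finset.Nat.sum_antidiagonal_eq_sum_range_succ_mk]
  simp only [f, PowerSeries.coeff_rescale, PowerSeries.coeff_mk]
  cases n with
  | zero => simp [fCoeff, fRHS]
  | succ k =>
    rw [Finset.sum_range_succ, Finset.sum_range_succ', Finset.sum_range]
    have h1 := h (k + 1) (Nat.succ_pos k)
    have h2 : fCoeff s N (k + 1) * (1 + xi s N ^ (k + 1))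
        = PowerSeries.coeff (k + 1) (fRHS s N)
          - ∑ j : Fin k, fCoeff s N (j + 1) * (fCoeff s N (k - j) * xi s N ^ (k - (j : ℕ))) := by
      rw [fCoeff, div_mul_cancel₀ _ h1]
    have h0 : fCoeff s N 0 = 1 := by simp [fCoeff]
    simp only [Nat.sub_self, Nat.sub_zero, h0, Nat.add_sub_add_right, pow_zero]
    have h3 : ∀ j : Fin k, fCoeff s N (j + 1) * (xi s N ^ (k - (j : ℕ)) * fCoeff s N (k - j))
        = fCoeff s N (j + 1) * (fCoeff s N (k - j) * xi s N ^ (k - (j : ℕ))) := fun j => by ring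
    simp only [h3]
    linear_combination h2

/-- A matrix over `K` regarded as a matrix of constant power series. -/
def const {K : Type*} [Field K] {I : Type*} (M : Matrix I I K) : Matrix I I K⟦X⟧ :=
  M.map PowerSeries.C

/-- The `R`-matrix `R(u) = f(u) (q⁻¹ (u - 1) (u - ξ) R - (q⁻² - 1) (u - ξ) P
+ (q⁻² - 1) (u - 1) ξ Q)`, a power series in `u`. -/
def Rser {K : Type*} [Field K] (s : K) (N : ℕ) :
    Matrix (Fin N × Fin N) (Fin N × Fin N) K⟦X⟧ :=
  f s N • (
    (PowerSeries.C (q s)⁻¹ * (PowerSeries.X - 1) * (PowerSeries.X - PowerSeries.C (xi s N)))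
      • const (R s N)
    - (PowerSeries.C ((q s)⁻¹ ^ 2 - 1) * (PowerSeries.X - PowerSeries.C (xi s N)))
      • const (P K N)
    + (PowerSeries.C ((q s)⁻¹ ^ 2 - 1) * (PowerSeries.X - 1) * PowerSeries.C (xi s N))
      • const (Q s N))

/-- The `R`-matrix `R̄(u) = (u - 1) / (u q - q⁻¹) R + (q - q⁻¹) / (u q - q⁻¹) P
- (q - q⁻¹) (u - 1) ξ / ((u q - q⁻¹) (u - ξ)) Q`; the rational functions are expanded as power
series in `u`. -/
def Rbarser {K : Type*} [Field K] (s : K) (N : ℕ) :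
    Matrix (Fin N × Fin N) (Fin N × Fin N) K⟦X⟧ :=
  ((PowerSeries.X - 1) * (PowerSeries.X * PowerSeries.C (q s) - PowerSeries.C (q s)⁻¹)⁻¹)
      • const (R s N)
    + (PowerSeries.C (q s - (q s)⁻¹)
        * (PowerSeries.X * PowerSeries.C (q s) - PowerSeries.C (q s)⁻¹)⁻¹) • const (P K N)
    - (PowerSeries.C (q s - (q s)⁻¹) * (PowerSeries.X - 1) * PowerSeries.C (xi s N)
        * (PowerSeries.X * PowerSeries.C (q s) - PowerSeries.C (q s)⁻¹)⁻¹
        * (PowerSeries.X - PowerSeries.C (xi s N))⁻¹) • const (Q s N)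

/-! ### The algebra attached to an `R`-matrix -/

/-- The two signs `±`. -/
inductive Sgn
  | plus
  | minus

/-- Given elements `l^±_{ij}[∓ m]`, `m ≥ 0`, this is the coefficient at `u ^ m`, `m ∈ ℤ`, of the
matrix `L^±(u) = ∑_{i, j} l^±_{ij}(u) ⊗ e_{ij}` with
`l^±_{ij}(u) = ∑_{m ≥ 0} l^±_{ij}[∓ m] u ^ (± m)`. -/
def modeMat {A : Type*} [Ring A] {N : ℕ} (l : Sgn → Fin N → Fin N → ℕ → A) :
    Sgn → ℤ → Matrix (Fin N) (Fin N) A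
  | .plus, m => if 0 ≤ m then Matrix.of fun i j => l .plus i j m.toNat else 0
  | .minus, m => if m ≤ 0 then Matrix.of fun i j => l .minus i j (-m).toNat else 0

/-- The coefficient at `u ^ k` of a matrix of power series, with entries mapped to `A`. -/
def coeffMat {K : Type*} [Field K] (A : Type*) [Ring A] [Algebra K A] {I : Type*}
    (Rm : Matrix I I K⟦X⟧) (k : ℕ) : Matrix I I A :=
  Rm.map fun r => algebraMap K A (PowerSeries.coeff k r)

/-- The coefficient at `u ^ a v ^ b` of `R(u w / v) L^{ε₁}_1(u) L^{ε₂}_2(v)`. The sum has only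
finitely many nonzero terms if `ε₁ = ε₂` or `(ε₁, ε₂) = (+, -)`; see `finite_support_rllLeft`. -/
def rllLeft {K : Type*} [Field K] {A : Type*} [Ring A] [Algebra K A] {N : ℕ}
    (Rm : Matrix (Fin N × Fin N) (Fin N × Fin N) K⟦X⟧)
    (l : Sgn → Fin N → Fin N → ℕ → A) (w : A) (ε₁ ε₂ : Sgn) (a b : ℤ) :
    Matrix (Fin N × Fin N) (Fin N × Fin N) A :=
  ∑ᶠ k : ℕ, w ^ k • (coeffMat A Rm k
    * (modeMat l ε₁ (a - k) ⊗ₖ (1 : Matrix (Fin N) (Fin N) A))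
    * ((1 : Matrix (Fin N) (Fin N) A) ⊗ₖ modeMat l ε₂ (b + k)))

/-- The coefficient at `u ^ a v ^ b` of `L^{ε₂}_2(v) L^{ε₁}_1(u) R(u w / v)`. -/
def rllRight {K : Type*} [Field K] {A : Type*} [Ring A] [Algebra K A] {N : ℕ}
    (Rm : Matrix (Fin N × Fin N) (Fin N × Fin N) K⟦X⟧)
    (l : Sgn → Fin N → Fin N → ℕ → A) (w : A) (ε₁ ε₂ : Sgn) (a b : ℤ) :
    Matrix (Fin N × Fin N) (Fin N × Fin N) A :=
  ∑ᶠ k : ℕ, w ^ k • (((1 : Matrix (Fin N) (Fin N) A) ⊗ₖ modeMat l ε₂ (b + k))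
    * (modeMat l ε₁ (a - k) ⊗ₖ (1 : Matrix (Fin N) (Fin N) A))
    * coeffMat A Rm k)

theorem modeMat_eq_zero {A : Type*} [Ring A] {N : ℕ} (l : Sgn → Fin N → Fin N → ℕ → A)
    (ε₁ ε₂ : Sgn) (hε : ¬ (ε₁ = .minus ∧ ε₂ = .plus)) (a b : ℤ) (k : ℕ)
    (hk : a.natAbs + b.natAbs < k) :
    modeMat l ε₁ (a - k) = 0 ∨ modeMat l ε₂ (b + k) = 0 := by
  cases ε₁ with
  | plus => left; simp only [modeMat]; rw [if_neg (by omega)]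
  | minus =>
    cases ε₂ with
    | plus => exact absurd ⟨rfl, rfl⟩ hε
    | minus => right; simp only [modeMat]; rw [if_neg (by omega)]

/-- Only the terms with `k ≤ |a| + |b|` contribute to `rllLeft`. -/
theorem finite_support_rllLeft {K : Type*} [Field K] {A : Type*} [Ring A] [Algebra K A] {N : ℕ}
    (Rm : Matrix (Fin N × Fin N) (Fin N × Fin N) K⟦X⟧)
    (l : Sgn → Fin N → Fin N → ℕ → A) (w : A) (ε₁ ε₂ : Sgn)
    (hε : ¬ (ε₁ = .minus ∧ ε₂ = .plus)) (a b : ℤ) :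
    rllLeft Rm l w ε₁ ε₂ a b = ∑ k ∈ Finset.range (a.natAbs + b.natAbs + 1),
      w ^ k • (coeffMat A Rm k
        * (modeMat l ε₁ (a - k) ⊗ₖ (1 : Matrix (Fin N) (Fin N) A))
        * ((1 : Matrix (Fin N) (Fin N) A) ⊗ₖ modeMat l ε₂ (b + k))) := by
  refine finsum_eq_sum_of_support_subset _ fun k hk => ?_
  by_contra hk'
  refine hk ?_
  rcases modeMat_eq_zero l ε₁ ε₂ hε a b k (by simpa using hk') with h | h <;> simp [h]

/-- Only the terms with `k ≤ |a| + |b|` contribute to `rllRight`. -/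
theorem finite_support_rllRight {K : Type*} [Field K] {A : Type*} [Ring A] [Algebra K A] {N : ℕ}
    (Rm : Matrix (Fin N × Fin N) (Fin N × Fin N) K⟦X⟧)
    (l : Sgn → Fin N → Fin N → ℕ → A) (w : A) (ε₁ ε₂ : Sgn)
    (hε : ¬ (ε₁ = .minus ∧ ε₂ = .plus)) (a b : ℤ) :
    rllRight Rm l w ε₁ ε₂ a b = ∑ k ∈ Finset.range (a.natAbs + b.natAbs + 1),
      w ^ k • (((1 : Matrix (Fin N) (Fin N) A) ⊗ₖ modeMat l ε₂ (b + k))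
        * (modeMat l ε₁ (a - k) ⊗ₖ (1 : Matrix (Fin N) (Fin N) A))
        * coeffMat A Rm k) := by
  refine finsum_eq_sum_of_support_subset _ fun k hk => ?_
  by_contra hk'
  refine hk ?_
  rcases modeMat_eq_zero l ε₁ ε₂ hε a b k (by simpa using hk') with h | h <;> simp [h]

/-- The generators `q^{c/2}`, `q^{-c/2}` and `l^±_{ij}[∓ m]`, `m ≥ 0`. -/
inductive Gen (N : ℕ)
  | qc
  | qcInv
  | l (ε : Sgn) (i j : Fin N) (m : ℕ)

/-- The generators `l^±_{ij}[∓ m]` in the free algebra. -/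
def freeL (K : Type*) [Field K] (N : ℕ) (ε : Sgn) (i j : Fin N) (m : ℕ) : FreeAlgebra K (Gen N) :=
  FreeAlgebra.ι K (Gen.l ε i j m)

/-- The defining relations of the algebra attached to the `R`-matrix `Rm`. -/
inductive Rel {K : Type*} [Field K] {N : ℕ}
    (Rm : Matrix (Fin N × Fin N) (Fin N × Fin N) K⟦X⟧) :
    FreeAlgebra K (Gen N) → FreeAlgebra K (Gen N) → Prop
  /-- `q^{c/2}` is invertible -/
  | qc_mul_inv : Rel Rm (FreeAlgebra.ι K Gen.qc * FreeAlgebra.ι K Gen.qcInv) 1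
  | inv_mul_qc : Rel Rm (FreeAlgebra.ι K Gen.qcInv * FreeAlgebra.ι K Gen.qc) 1
  /-- `q^{c/2}` is central -/
  | qc_comm (ε : Sgn) (i j : Fin N) (m : ℕ) :
      Rel Rm (FreeAlgebra.ι K Gen.qc * freeL K N ε i j m) (freeL K N ε i j m * FreeAlgebra.ι K Gen.qc)
  /-- `l^+_{ij}[0] = 0` for `i > j` -/
  | plus_zero (i j : Fin N) (h : j < i) : Rel Rm (freeL K N .plus i j 0) 0
  /-- `l^-_{ji}[0] = 0` for `i > j` -/
  | minus_zero (i j : Fin N) (h : j < i) : Rel Rm (freeL K N .minus j i 0) 0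
  /-- `l^+_{ii}[0] l^-_{ii}[0] = 1` -/
  | plus_mul_minus (i : Fin N) : Rel Rm (freeL K N .plus i i 0 * freeL K N .minus i i 0) 1
  /-- `l^-_{ii}[0] l^+_{ii}[0] = 1` -/
  | minus_mul_plus (i : Fin N) : Rel Rm (freeL K N .minus i i 0 * freeL K N .plus i i 0) 1
  /-- `R(u/v) L^±_1(u) L^±_2(v) = L^±_2(v) L^±_1(u) R(u/v)`, all coefficients and entries -/
  | rll (ε : Sgn) (a b : ℤ) (x y : Fin N × Fin N) :
      Rel Rm (rllLeft Rm (freeL K N) 1 ε ε a b x y) (rllRight Rm (freeL K N) 1 ε ε a b x y)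
  /-- `R(u q^c / v) L^+_1(u) L^-_2(v) = L^-_2(v) L^+_1(u) R(u q^{-c} / v)`,
  all coefficients and entries -/
  | rll_mixed (a b : ℤ) (x y : Fin N × Fin N) :
      Rel Rm (rllLeft Rm (freeL K N) (FreeAlgebra.ι K Gen.qc ^ 2) .plus .minus a b x y)
        (rllRight Rm (freeL K N) (FreeAlgebra.ι K Gen.qcInv ^ 2) .plus .minus a b x y)

/-- The unital associative algebra with generators `Gen N` and relations `Rel Rm`. -/
abbrev RAlg {K : Type*} [Field K] {N : ℕ}
    (Rm : Matrix (Fin N × Fin N) (Fin N × Fin N) K⟦X⟧) : Type _ :=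
  RingQuot (Rel Rm)

/-- The algebra `U(R)`. -/
abbrev UR {K : Type*} [Field K] (s : K) (N : ℕ) : Type _ := RAlg (Rser s N)

/-- The algebra `U(R̄)`. -/
abbrev URbar {K : Type*} [Field K] (s : K) (N : ℕ) : Type _ := RAlg (Rbarser s N)

/-- The generator `l^±_{ij}[∓ m]` of the algebra. -/
def gen {K : Type*} [Field K] {N : ℕ} (Rm : Matrix (Fin N × Fin N) (Fin N × Fin N) K⟦X⟧)
    (ε : Sgn) (i j : Fin N) (m : ℕ) : RAlg Rm :=
  RingQuot.mkAlgHom K (Rel Rm) (freeL K N ε i j m)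

/-! ### The matrices `L^±(u)`, their transposes, and `D`

Series in `u` (sign `+`) and series in `u⁻¹` (sign `-`) are both modelled by power series; the
formal variable is `u` for the sign `+`, and `u⁻¹` for the sign `-`. -/

/-- The scalar by which the formal variable `u^{±1}` is multiplied when `u` is replaced by `u c`. -/
def Sgn.act {K : Type*} [Field K] : Sgn → K → K
  | .plus, c => c
  | .minus, c => c⁻¹

/-- The matrix `L^±(u c)` for a scalar `c`: the entries are
`l^±_{ij}(u c) = ∑_{m ≥ 0} l^±_{ij}[∓ m] c ^ (± m) u ^ (± m)`. -/
def Lmat {K : Type*} [Field K] {N : ℕ} (Rm : Matrix (Fin N × Fin N) (Fin N × Fin N) K⟦X⟧)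
    (ε : Sgn) (c : K) : Matrix (Fin N) (Fin N) (RAlg Rm)⟦X⟧ :=
  Matrix.of fun i j => PowerSeries.mk fun m => (ε.act c) ^ m • gen Rm ε i j m

/-- The matrix transposition `t` with `e_{ij}^t = e_{j'i'}`, that is, `(M^t)_{ij} = M_{j'i'}`. -/
def tr {A : Type*} {N : ℕ} (M : Matrix (Fin N) (Fin N) A) : Matrix (Fin N) (Fin N) A :=
  Matrix.of fun i j => M j.rev i.rev

/-- `D = diag [q^{1̄}, …, q^{N̄}]`. -/
def D {K : Type*} [Field K] (s : K) (N : ℕ) : Matrix (Fin N) (Fin N) K :=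
  Matrix.diagonal fun i => s ^ bar2 i

/-- A matrix over `K` regarded as a matrix over the power series with coefficients in `A`. -/
def lift {K : Type*} [Field K] (A : Type*) [Ring A] [Algebra K A] {N : ℕ}
    (M : Matrix (Fin N) (Fin N) K) : Matrix (Fin N) (Fin N) A⟦X⟧ :=
  M.map (algebraMap K A⟦X⟧)

end QAffineBD

end

/-! Up to an invertible power series, both R-matrices equal the quadratic polynomial `Rpoly`, and at
u = ξ the factor u - ξ kills its R and P terms and leaves a nonzero multiple of Q. An exchange
relation between two matrices of the same sign does not see such a scalar factor
(`rllLeft_eq_rllRight_of_smul`). Once the factor is removed, u = vξ may be substituted, which gives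
Q L_1(vξ) L_2(v) = L_2(v) L_1(vξ) Q (`sum_Q_mul_lSer`). Since Q has rank one, both sides are one
series z(v) times Q, and the entries of this identity are the two formulas for z
(`exists_series_of_rll`, `exists_scalar_of_rll`).

Centrality rests on crossing symmetry (`crossing_Rser`): D_1 R(uξ)^{t_1} D_1^{-1} R(u) is the
constant ξ² q^{-2}. The series z is a contraction of L(uξ) with L(u). Moving a further generator
matrix through this pair produces R(uξ/v) contracted with R(u/v) on either side, and crossing turns
each contraction into the same nonzero constant (`commute_of_fusion_left`,
`commute_of_fusion_right`). In the mixed relation the two sides carry the arguments uq^c/v and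
uq^{-c}/v, so the contraction must not depend on u; the series f is chosen for exactly this.

Crossing is a computation in the Birman–Murakami–Wenzl algebra. For Ř = PR and E = PQ one has the
skein relation Ř^{-1} = Ř - (q - q^{-1})(1 - E), the eigenvalue relation ŘE = q^{-1}ξE, and E² = κE.
Twisted transposition in the first factor sends R to R^{-1}, Q to P, and P to PQP. From these facts
the product collapses to a scalar (`crossing_of_relations`). The relations are checked on matrix
entries, the one real input being a telescoping geometric sum (`sum_lt_bar2`). -/

namespace QAffineBD

/-! ### Matrix entries of P, Q and R. -/

section Entries

variable {K : Type*} [Field K] {N : ℕ}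

theorem bar2_rev (i : Fin N) : bar2 i.rev = -bar2 i := by
  have := i.isLt
  simp only [bar2, Fin.val_rev]
  split_ifs <;> omega

theorem qbar_mul_qbar {s : K} (hs : s ≠ 0) (i j k : Fin N) :
    qbar s i j * qbar s j k = qbar s i k := by
  simp only [qbar, ← zpow_add₀ hs]
  congr 1
  ring

@[simp] theorem qbar_self (s : K) (i : Fin N) : qbar s i i = 1 := by simp [qbar]

theorem qbar_rev (s : K) (i j : Fin N) : qbar s i.rev j.rev = qbar s j i := by
  simp only [qbar, bar2_rev]
  congr 1
  ring

/-- The coefficient of `e_{aa} ⊗ e_{bb}` in `R`. -/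
noncomputable def diagCoeff (s : K) (a b : Fin N) : K :=
  if a = b then (if a = a.rev then 1 else q s) else if b = a.rev then (q s)⁻¹ else 1

theorem e_kronecker_apply (i j k l a b c d : Fin N) :
    ((e i j : Matrix _ _ K) ⊗ₖ e k l) (a, b) (c, d)
      = if i = a ∧ j = c ∧ k = b ∧ l = d then 1 else 0 := by
  simp only [Matrix.kroneckerMap_apply, e, Matrix.single_apply]
  split_ifs <;> simp_all

theorem P_apply (a b c d : Fin N) :
    P K N (a, b) (c, d) = if a = d ∧ b = c then 1 else 0 := by
  simp only [P, Matrix.sum_apply, e_kronecker_apply]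
  rw [Finset.sum_eq_single a, Finset.sum_eq_single c]
  · grind
  · intro x _ hx
    rw [if_neg (by tauto)]
  · simp
  · intro x _ hx
    exact Finset.sum_eq_zero fun y _ => by rw [if_neg (by tauto)]
  · simp

theorem Q_apply (s : K) (a b c d : Fin N) :
    Q s N (a, b) (c, d) = if b = a.rev ∧ d = c.rev then qbar s c a else 0 := by
  simp only [Q, Matrix.sum_apply, Matrix.smul_apply, e_kronecker_apply]
  rw [Finset.sum_eq_single b, Finset.sum_eq_single d]
  · by_cases h : b = a.rev ∧ d = c.rev
    · obtain ⟨rfl, rfl⟩ := h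
      simp [qbar_rev]
    · rw [if_neg h, if_neg, smul_zero]
      rintro ⟨rfl, rfl, -⟩
      simp at h
  · intro x _ hx
    rw [if_neg (by tauto), smul_zero]
  · simp
  · intro x _ hx
    exact Finset.sum_eq_zero fun y _ => by rw [if_neg (by tauto), smul_zero]
  · simp

theorem ite_zero_apply {m n α : Type*} [Zero α] (p : Prop) [Decidable p] (M : Matrix m n α)
    (x : m) (y : n) : (if p then M else 0) x y = if p then M x y else 0 := by
  split_ifs <;> rfl

theorem sum_ite_kronecker_diag (p : Fin N → Prop) [DecidablePred p] (g : Fin N → Fin N)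
    (a b c d : Fin N) :
    (∑ i : Fin N, if p i then (e i i : Matrix _ _ K) ⊗ₖ e (g i) (g i) else 0) (a, b) (c, d)
      = if a = c ∧ b = d ∧ b = g a ∧ p a then 1 else 0 := by
  simp only [Matrix.sum_apply, ite_zero_apply, e_kronecker_apply]
  rw [Finset.sum_eq_single a]
  · grind
  · intro x _ hx
    simp [hx]
  · simp

theorem R_apply (s : K) (a b c d : Fin N) :
    R s N (a, b) (c, d) = (if a = c ∧ b = d then diagCoeff s a b else 0)
      + (if a = d ∧ b = c ∧ a < b then q s - (q s)⁻¹ else 0)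
      - (if b = a.rev ∧ d = c.rev ∧ a < c then (q s - (q s)⁻¹) * qbar s c a else 0) := by
  have h3 : (∑ i : Fin N, ∑ j : Fin N,
      if i ≠ j ∧ i ≠ j.rev then (e i i : Matrix _ _ K) ⊗ₖ e j j else 0) (a, b) (c, d)
      = if a = c ∧ b = d ∧ a ≠ b ∧ b ≠ a.rev then 1 else 0 := by
    simp only [Matrix.sum_apply, ite_zero_apply, e_kronecker_apply]
    rw [Finset.sum_eq_single a, Finset.sum_eq_single b]
    · have : a = b.rev ↔ b = a.rev := by rw [eq_comm, Fin.rev_eq_iff]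
      grind
    · intro x _ hx
      simp [hx]
    · simp
    · intro x _ hx
      exact Finset.sum_eq_zero fun y _ => by simp [hx]
    · simp
  have h5 : (∑ i : Fin N, ∑ j : Fin N,
      if i < j then (e i j : Matrix _ _ K) ⊗ₖ e j i else 0) (a, b) (c, d)
      = if a = d ∧ b = c ∧ a < b then 1 else 0 := by
    simp only [Matrix.sum_apply, ite_zero_apply, e_kronecker_apply]
    rw [Finset.sum_eq_single a, Finset.sum_eq_single b]
    · grind
    · intro x _ hx
      simp [hx]
    · simp
    · intro x _ hx
      exact Finset.sum_eq_zero fun y _ => by simp [hx]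
    · simp
  have h6 : (∑ i : Fin N, ∑ j : Fin N,
      if j < i then qbar s i j • ((e i.rev j.rev : Matrix _ _ K) ⊗ₖ e i j) else 0) (a, b) (c, d)
      = if b = a.rev ∧ d = c.rev ∧ a < c then qbar s c a else 0 := by
    simp only [Matrix.sum_apply, ite_zero_apply, Matrix.smul_apply, e_kronecker_apply]
    rw [Finset.sum_eq_single b, Finset.sum_eq_single d]
    · by_cases h : b = a.rev ∧ d = c.rev
      · obtain ⟨rfl, rfl⟩ := h
        simp [qbar_rev]
      · have h' : ¬ (b.rev = a ∧ d.rev = c) := by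
          rw [Fin.rev_eq_iff, Fin.rev_eq_iff]; exact h
        rw [if_neg (c := b = a.rev ∧ d = c.rev ∧ a < c) (by tauto),
          if_neg (c := b.rev = a ∧ d.rev = c ∧ b = b ∧ d = d) (by tauto), smul_zero, ite_self]
    · intro x _ hx
      simp [hx]
    · simp
    · intro x _ hx
      exact Finset.sum_eq_zero fun y _ => by simp [hx]
    · simp
  simp only [R, Matrix.add_apply, Matrix.sub_apply, Matrix.smul_apply, h3, h5, h6]
  rw [sum_ite_kronecker_diag (fun i => i ≠ i.rev) (fun i => i) a b c d,
    sum_ite_kronecker_diag (fun i => i = i.rev) (fun i => i) a b c d,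
    sum_ite_kronecker_diag (fun i => i ≠ i.rev) (fun i => i.rev) a b c d]
  simp only [diagCoeff, smul_eq_mul]
  congr 1
  · congr 1
    · split_ifs <;> grind
    · split_ifs <;> simp
  · split_ifs <;> simp

theorem P_mul_apply (M : Matrix (Fin N × Fin N) (Fin N × Fin N) K)
    (a b : Fin N) (y : Fin N × Fin N) : (P K N * M) (a, b) y = M (b, a) y := by
  rw [Matrix.mul_apply, Finset.sum_eq_single (b, a)]
  · simp [P_apply]
  · rintro ⟨c, d⟩ _ h
    rw [P_apply, if_neg, zero_mul]
    rintro ⟨rfl, rfl⟩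
    exact h rfl
  · simp

theorem mul_P_apply (M : Matrix (Fin N × Fin N) (Fin N × Fin N) K)
    (x : Fin N × Fin N) (c d : Fin N) : (M * P K N) x (c, d) = M x (d, c) := by
  rw [Matrix.mul_apply, Finset.sum_eq_single (d, c)]
  · simp [P_apply]
  · rintro ⟨a, b⟩ _ h
    rw [P_apply, if_neg, mul_zero]
    rintro ⟨rfl, rfl⟩
    exact h rfl
  · simp

end Entries

/-! ### Twisted partial transposition, full transposition, and the telescoping sum. -/

section Relations

variable {K : Type*} [Field K] {N : ℕ}

/-- The linear map `M ↦ D₁ M^{t₁} D₁⁻¹`. -/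
noncomputable def star {F : Type*} [CommRing F] [Algebra K F] (s : K)
    (M : Matrix (Fin N × Fin N) (Fin N × Fin N) F) :
    Matrix (Fin N × Fin N) (Fin N × Fin N) F :=
  Matrix.of fun x y => qbar s x.1 y.1 • M (y.1.rev, x.2) (x.1.rev, y.2)

/-- Transposing one tensor factor turns the flip into the rank-one operator and conversely;
conjugation by P records which factor was transposed. -/
theorem star_P (s : K) : star s (P K N) = P K N * Q s N * P K N := by
  ext ⟨a, b⟩ ⟨c, d⟩
  rw [mul_P_apply, P_mul_apply, star, Matrix.of_apply, P_apply, Q_apply]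
  have h1 : c.rev = d ↔ d = c.rev := eq_comm
  by_cases h : d = c.rev ∧ b = a.rev
  · obtain ⟨rfl, rfl⟩ := h
    simp [qbar_rev]
  · rw [if_neg (by tauto), if_neg, smul_zero]
    have h2 : a = b.rev ↔ b = a.rev := by rw [eq_comm, Fin.rev_eq_iff]
    have h3 : c = d.rev ↔ d = c.rev := by rw [eq_comm, Fin.rev_eq_iff]
    tauto

theorem star_Q {s : K} (hs : s ≠ 0) : star s (Q s N) = P K N := by
  ext ⟨a, b⟩ ⟨c, d⟩
  rw [star, Matrix.of_apply, P_apply, Q_apply]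
  simp only [Fin.rev_rev, qbar_rev]
  by_cases h : a = d ∧ b = c
  · obtain ⟨rfl, rfl⟩ := h
    simp [qbar_mul_qbar hs]
  · rw [if_neg (by tauto), if_neg h, smul_zero]

/-- Transposition swaps the two off-diagonal sums, which accounts for their signs. On the diagonal
it exchanges q and q^{-1}; writing q^{-1} = q - (q - q^{-1}) absorbs this exchange into the sums,
and so their strict inequalities become weak. -/
theorem star_R_apply {s : K} (hs : s ≠ 0) (a b c d : Fin N) :
    star s (R s N) (a, b) (c, d) = (if a = c ∧ b = d then diagCoeff s a b else 0)
      - (if a = d ∧ b = c ∧ a ≤ b then q s - (q s)⁻¹ else 0)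
      + (if b = a.rev ∧ d = c.rev ∧ a ≤ c then (q s - (q s)⁻¹) * qbar s a c else 0) := by
  rw [star, Matrix.of_apply, R_apply]
  simp only [Fin.rev_rev, qbar_rev, diagCoeff, smul_eq_mul, mul_add, mul_sub, mul_ite, mul_zero]
  have h2 : qbar s a c * ((q s - (q s)⁻¹) * qbar s c a) = q s - (q s)⁻¹ := by
    linear_combination (q s - (q s)⁻¹) * qbar_mul_qbar hs a c a +
      (q s - (q s)⁻¹) * qbar_self s a
  rw [h2]
  have e1 : ∀ x y : Fin N, x.rev = y ↔ y = x.rev := fun x y => eq_comm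
  by_cases hac : a = c
  · subst hac
    simp only [qbar_self, one_mul, e1, le_refl, lt_irrefl, and_false, if_false,
      true_and, and_true, sub_zero]
    by_cases hbd : b = d
    · subst hbd
      rw [if_neg (c := b = a.rev ∧ b = a.rev ∧ a.rev < b) (by grind)]
      by_cases hab : a = b
      · subst hab
        by_cases ha : a = a.rev
        · simp [← ha]
        · simp [ha]
      · by_cases ha : b = a.rev
        · subst ha
          simp [hab, Ne.symm hab]
        · simp [hab, ha, Ne.symm hab]
    · grind
  · have e3 : c.rev = d ∧ b = a.rev ∧ c.rev < b ↔ b = a.rev ∧ d = c.rev ∧ a ≤ c := by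
      constructor
      · rintro ⟨rfl, rfl, h⟩
        exact ⟨rfl, rfl, (Fin.rev_lt_rev.1 h).le⟩
      · rintro ⟨rfl, rfl, h⟩
        exact ⟨rfl, rfl, Fin.rev_lt_rev.2 (lt_of_le_of_ne h hac)⟩
    have e4 : b = c ∧ d = a ∧ c.rev < a.rev ↔ a = d ∧ b = c ∧ a ≤ b := by
      constructor
      · rintro ⟨rfl, rfl, h⟩
        exact ⟨rfl, rfl, (Fin.rev_lt_rev.1 h).le⟩
      · rintro ⟨rfl, rfl, h⟩
        exact ⟨rfl, rfl, Fin.rev_lt_rev.2 (lt_of_le_of_ne h hac)⟩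
    have e5 : ¬ (c.rev = a.rev ∧ b = d) := fun h => hac (Fin.rev_injective h.1).symm
    rw [if_neg e5]
    simp only [e3, e4, hac, false_and, if_false, mul_comm (qbar s a c), sub_mul]
    ring

theorem P_mul_P : P K N * P K N = 1 := by
  ext ⟨a, b⟩ ⟨c, d⟩
  rw [P_mul_apply, P_apply, Matrix.one_apply]
  simp only [Prod.mk.injEq]
  congr 1
  simp only [eq_iff_iff]
  tauto

/-- With its analogues for Q and P, this carries identities from one tensor factor to the other
without a second entrywise computation. -/
theorem R_transpose (s : K) : (R s N).transpose = P K N * R s N * P K N := by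
  ext ⟨a, b⟩ ⟨c, d⟩
  rw [mul_P_apply, P_mul_apply, Matrix.transpose_apply, R_apply, R_apply]
  have h2 : a = b.rev ↔ b = a.rev := by rw [eq_comm, Fin.rev_eq_iff]
  have h3 : c = d.rev ↔ d = c.rev := by rw [eq_comm, Fin.rev_eq_iff]
  have e2 : a = a.rev ↔ a.rev = a := eq_comm
  congr 1
  · congr 1
    · by_cases h : a = c ∧ b = d
      · obtain ⟨rfl, rfl⟩ := h
        simp only [diagCoeff, h2, and_self]
        split_ifs <;> grind
      · rw [if_neg (by tauto), if_neg (by tauto)]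
    · grind
  · by_cases h : b = a.rev ∧ d = c.rev
    · obtain ⟨rfl, rfl⟩ := h
      simp [qbar_rev]
    · rw [if_neg (by tauto), if_neg (by tauto)]

theorem Q_transpose (s : K) : (Q s N).transpose = P K N * Q s N * P K N := by
  ext ⟨a, b⟩ ⟨c, d⟩
  rw [mul_P_apply, P_mul_apply, Matrix.transpose_apply, Q_apply, Q_apply]
  have h2 : a = b.rev ↔ b = a.rev := by rw [eq_comm, Fin.rev_eq_iff]
  have h3 : c = d.rev ↔ d = c.rev := by rw [eq_comm, Fin.rev_eq_iff]
  by_cases h : d = c.rev ∧ b = a.rev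
  · obtain ⟨rfl, rfl⟩ := h
    simp [qbar_rev]
  · rw [if_neg (by tauto), if_neg (by tauto)]

theorem P_transpose : (P K N).transpose = P K N := by
  ext ⟨a, b⟩ ⟨c, d⟩
  rw [Matrix.transpose_apply, P_apply, P_apply]
  congr 1
  simp only [eq_iff_iff]
  constructor <;> rintro ⟨rfl, rfl⟩ <;> simp

/-- The defect of the telescoping sum `sum_lt_bar2` at the middle of the index set. -/
noncomputable def midDefect (s : K) (i : Fin N) : K :=
  if i < i.rev then 0 else if i = i.rev then 1 - (q s)⁻¹ else q s - (q s)⁻¹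

/-- Away from the middle `bar2` drops by 2 at each step, so each summand is the difference of two
consecutive values of s^(-2 - 2 bar2). The irregular step at the middle contributes `midDefect`, and
s^(2 - 2N) is the value at the first index. -/
theorem sum_lt_bar2 {s : K} (hs : s ≠ 0) (i : Fin N) :
    (∑ c : Fin N, if c < i then (q s - (q s)⁻¹) * s ^ (-2 * bar2 c) else 0)
      = s ^ (-2 - 2 * bar2 i) - s ^ (2 - 2 * (N : ℤ)) + midDefect s i := by
  obtain ⟨k, hk⟩ := i
  induction k with
  | zero =>
    have h0 : ∀ c : Fin N, ¬ c < (⟨0, hk⟩ : Fin N) := fun c => by simp [Fin.lt_def]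
    simp only [h0, if_false, Finset.sum_const_zero]
    -- For N = 1 the first index is also the middle one, and the defect is already nonzero there.
    by_cases hN : N = 1
    · subst hN
      simp [bar2, midDefect, q, zpow_neg]
    · have h1 : bar2 (⟨0, hk⟩ : Fin N) = N - 2 := by
        simp only [bar2]
        split_ifs <;> simp at * <;> omega
      have h2 : (⟨0, hk⟩ : Fin N) < (⟨0, hk⟩ : Fin N).rev := by
        simp only [Fin.lt_def, Fin.val_rev]; omega
      rw [h1, midDefect, if_pos h2, show (-2 - 2 * ((N : ℤ) - 2)) = 2 - 2 * N by ring]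
      ring
  | succ k ih =>
    have hk' : k < N := by omega
    have h1 : ∀ c : Fin N, (if c < (⟨k + 1, hk⟩ : Fin N) then
          (q s - (q s)⁻¹) * s ^ (-2 * bar2 c) else 0)
        = (if c < (⟨k, hk'⟩ : Fin N) then (q s - (q s)⁻¹) * s ^ (-2 * bar2 c) else 0)
          + if c = ⟨k, hk'⟩ then (q s - (q s)⁻¹) * s ^ (-2 * bar2 c) else 0 := by
      intro c
      simp only [Fin.lt_def, Fin.ext_iff]
      grind
    rw [Finset.sum_congr rfl fun c _ => h1 c, Finset.sum_add_distrib, ih hk',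
      Finset.sum_ite_eq' Finset.univ, if_pos (Finset.mem_univ _)]
    have hz : ∀ β : ℤ, s ^ (-2 - 2 * (β - 2)) = s ^ (-2 * β) * s ^ 2 ∧
        s ^ (-2 - 2 * β) = s ^ (-2 * β) * (s ^ 2)⁻¹ := by
      intro β
      rw [← zpow_natCast s 2, ← zpow_neg, ← zpow_add₀ hs, ← zpow_add₀ hs]
      exact ⟨by congr 1; push_cast; ring, by congr 1; push_cast; ring⟩
    have hm : ∀ (m : ℕ) (hm : m < N), midDefect s (⟨m, hm⟩ : Fin N)
        = if 2 * (m + 1) < N + 1 then 0 else if 2 * (m + 1) = N + 1 then 1 - (q s)⁻¹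
          else q s - (q s)⁻¹ := by
      intro m hm
      simp only [midDefect, Fin.lt_def, Fin.ext_iff, Fin.val_rev]
      congr 1
      · simp only [eq_iff_iff]; omega
      · congr 1
        simp only [eq_iff_iff]; omega
    rw [hm, hm]
    simp only [bar2]
    push_cast
    -- Next to the middle `bar2` drops by 1 on entering and on leaving the middle index of odd N,
    -- and by 0 between the two middle indices of even N; these are the steps at which the defect
    -- jumps.
    rcases lt_trichotomy (2 * (k + 1)) (N + 1) with h | h | h
    · rcases lt_trichotomy (2 * (k + 1 + 1)) (N + 1) with h' | h' | h'
      · rw [if_pos (by omega), if_pos (by omega), if_pos (by omega), if_pos (by omega),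
          show (N : ℤ) - 2 * (k + 1 + 1) = N - 2 * (k + 1) - 2 by ring, (hz _).1, (hz _).2, q]
        ring
      · rw [if_pos (by omega), if_pos (by omega), if_neg (by omega), if_pos (by omega),
          if_neg (by omega), if_pos (by omega), show (N : ℤ) - 2 * (k + 1) = 1 by omega, q,
          (hz 1).2]
        have : s ^ (-2 * (1 : ℤ)) = (s ^ 2)⁻¹ := by simp [zpow_neg]
        have h5 : s ^ (-2 - 2 * (0 : ℤ)) = (s ^ 2)⁻¹ := by simp [zpow_neg]
        rw [this, h5]
        field_simp
        ring
      · rw [if_pos (by omega), if_pos (by omega), if_neg (by omega), if_neg (by omega),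
          if_neg (by omega), if_neg (by omega), show (N : ℤ) - 2 * (k + 1) = 0 by omega, q,
          show (N : ℤ) - 2 * (k + 1 + 1) + 2 = 0 by omega]
        simp
    · rw [if_neg (by omega), if_pos (by omega), if_neg (by omega), if_pos (by omega),
        if_neg (by omega), if_neg (by omega), if_neg (by omega), if_neg (by omega), q,
        show (N : ℤ) - 2 * (k + 1 + 1) + 2 = -1 by omega]
      simp
    · rw [if_neg (by omega), if_neg (by omega), if_neg (by omega), if_neg (by omega),
        if_neg (by omega), if_neg (by omega), if_neg (by omega), if_neg (by omega),
        show (N : ℤ) - 2 * (k + 1 + 1) + 2 = N - 2 * (k + 1) + 2 - 2 by ring, (hz _).1, (hz _).2, q]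
      ring

end Relations

/-! ### Birman–Murakami–Wenzl relations among P, Q, R and the transposed R. -/

section Products

variable {K : Type*} [Field K] {N : ℕ}

theorem q_ne_zero {s : K} (hs : s ≠ 0) : q s ≠ 0 := pow_ne_zero 2 hs

theorem diagCoeff_comm (s : K) (a b : Fin N) : diagCoeff s a b = diagCoeff s b a := by
  have h2 : a = b.rev ↔ b = a.rev := by rw [eq_comm, Fin.rev_eq_iff]
  simp only [diagCoeff, h2]
  split_ifs <;> grind

/-- The skein relation: once `star s (R s N)` is known to be R^{-1}, the left side is the inverse of
PR. -/
theorem star_R_mul_P {s : K} (hs : s ≠ 0) :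
    star s (R s N) * P K N = P K N * R s N - (q s - (q s)⁻¹) • 1
      + (q s - (q s)⁻¹) • (P K N * Q s N) := by
  ext ⟨a, b⟩ ⟨c, d⟩
  rw [mul_P_apply, Matrix.add_apply, Matrix.sub_apply, Matrix.smul_apply, Matrix.smul_apply,
    P_mul_apply, P_mul_apply, star_R_apply hs, R_apply, Q_apply, Matrix.one_apply]
  have e2 : ∀ x y : Fin N, x = y.rev ↔ y = x.rev := fun x y => by rw [eq_comm, Fin.rev_eq_iff]
  simp only [Prod.mk.injEq, smul_eq_mul, mul_ite, mul_one, mul_zero, diagCoeff_comm s b a,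
    e2 a b, e2 d c]
  by_cases hb : b = a.rev ∧ c = d.rev
  · obtain ⟨rfl, rfl⟩ := hb
    have h3 : a.rev < d.rev ↔ ¬ a ≤ d := by rw [Fin.rev_lt_rev, not_le]
    simp only [and_self, true_and, if_true, qbar_rev, h3]
    grind
  · grind

/-- R preserves the span of the vectors e_a ⊗ e_{a'} and the span of the remaining basis vectors, so
products may be computed block by block. -/
theorem R_apply_of_ne (s : K) {a b c d : Fin N} (h : ¬ (b = a.rev ↔ d = c.rev)) :
    R s N (a, b) (c, d) = 0 := by
  have h2 : a = b.rev ↔ b = a.rev := by rw [eq_comm, Fin.rev_eq_iff]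
  have h3 : c = d.rev ↔ d = c.rev := by rw [eq_comm, Fin.rev_eq_iff]
  rw [R_apply]
  grind

/-- The matrix of `R` on the span of the vectors `e_a ⊗ e_{a'}`. -/
theorem R_apply_rev (s : K) (a c : Fin N) :
    R s N (a, a.rev) (c, c.rev) = (if a = c then diagCoeff s a a.rev else 0)
      + (if c = a.rev ∧ a < a.rev then q s - (q s)⁻¹ else 0)
      - (if a < c then (q s - (q s)⁻¹) * qbar s c a else 0) := by
  rw [R_apply]
  have h1 : a = c.rev ∧ a.rev = c ∧ a < a.rev ↔ c = a.rev ∧ a < a.rev := by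
    constructor
    · rintro ⟨-, rfl, h⟩; exact ⟨rfl, h⟩
    · rintro ⟨rfl, h⟩; exact ⟨(Fin.rev_rev a).symm, rfl, h⟩
  have h2 : a = c ∧ a.rev = c.rev ↔ a = c := by simp
  simp only [h1, h2, true_and]

theorem bar2_eq_zero {i : Fin N} (h : i = i.rev) : bar2 i = 0 := by
  have := bar2_rev i
  rw [← h] at this
  omega

theorem sum_gt_bar2 {s : K} (hs : s ≠ 0) (i : Fin N) :
    (∑ c : Fin N, if i < c then (q s - (q s)⁻¹) * s ^ (2 * bar2 c) else 0)
      = s ^ (2 * bar2 i - 2) - s ^ (2 - 2 * (N : ℤ)) + midDefect s i.rev := by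
  have h := sum_lt_bar2 hs i.rev
  rw [← Equiv.sum_comp Fin.revPerm] at h
  simp only [Fin.revPerm_apply, Fin.rev_lt_rev, bar2_rev] at h
  rw [show 2 * bar2 i - 2 = -2 - 2 * -bar2 i by ring, ← h]
  simp

/-- Evaluates the scalar κ in E² = κE: every index but the first exceeds the first, so the
telescoping sum covers all remaining terms. -/
theorem sum_bar2 {s : K} (hs : s ≠ 0) (hN : 2 ≤ N) :
    (q s - (q s)⁻¹) * ∑ c : Fin N, s ^ (2 * bar2 c)
      = s ^ (2 * (N : ℤ) - 2) - s ^ (2 - 2 * (N : ℤ)) + (q s - (q s)⁻¹) := by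
  let i : Fin N := ⟨0, by omega⟩
  have hi : bar2 i = N - 2 := by
    simp only [bar2, i]
    split_ifs <;> simp at * <;> omega
  have hm : midDefect s i.rev = q s - (q s)⁻¹ := by
    rw [midDefect, if_neg, if_neg]
    · simp only [Fin.ext_iff, Fin.rev_rev, Fin.val_rev, i]; omega
    · simp only [Fin.lt_def, Fin.rev_rev, Fin.val_rev, i]; omega
  have h := sum_gt_bar2 hs i
  rw [hm, hi] at h
  have h1 : ∀ c : Fin N, (q s - (q s)⁻¹) * s ^ (2 * bar2 c)
      = (if i < c then (q s - (q s)⁻¹) * s ^ (2 * bar2 c) else 0)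
        + if c = i then (q s - (q s)⁻¹) * s ^ (2 * bar2 c) else 0 := by
    intro c
    simp only [Fin.lt_def, Fin.ext_iff, i]
    grind
  rw [Finset.mul_sum, Finset.sum_congr rfl fun c _ => h1 c, Finset.sum_add_distrib, h,
    Finset.sum_ite_eq' Finset.univ, if_pos (Finset.mem_univ _), hi, q]
  have h2 : s ^ (2 * (N : ℤ) - 2) = s ^ (2 * ((N : ℤ) - 2)) * s ^ 2 := by
    rw [← zpow_natCast s 2, ← zpow_add₀ hs]; congr 1; push_cast; ring
  have h3 : s ^ (2 * ((N : ℤ) - 2) - 2) = s ^ (2 * ((N : ℤ) - 2)) * (s ^ 2)⁻¹ := by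
    rw [← zpow_natCast s 2, ← zpow_neg, ← zpow_add₀ hs]; congr 1
  rw [h2, h3]
  ring

theorem Q_mul_P_mul_Q {s : K} (hs : s ≠ 0) :
    Q s N * P K N * Q s N = (∑ c : Fin N, s ^ (2 * bar2 c)) • Q s N := by
  ext ⟨a, b⟩ ⟨e, f⟩
  rw [Matrix.mul_apply, Matrix.smul_apply, Q_apply, Fintype.sum_prod_type]
  simp only [mul_P_apply, Q_apply]
  by_cases h : b = a.rev ∧ f = e.rev
  · obtain ⟨rfl, rfl⟩ := h
    simp only [true_and, and_true, if_true, smul_eq_mul]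
    rw [Finset.sum_mul, ← Equiv.sum_comp Fin.revPerm]
    refine Finset.sum_congr rfl fun c _ => ?_
    rw [Finset.sum_eq_single c]
    · simp only [Fin.revPerm_apply, Fin.rev_rev, if_true, qbar, bar2_rev, ← zpow_add₀ hs]
      congr 1
      ring
    · intro x _ hx
      simp [hx]
    · simp
  · rw [if_neg h, smul_zero]
    refine Finset.sum_eq_zero fun c _ => Finset.sum_eq_zero fun d _ => ?_
    by_cases hb : b = a.rev
    · rw [if_neg (c := _ ∧ f = e.rev) (by tauto), mul_zero]
    · rw [if_neg (by tauto), zero_mul]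

theorem q_inv_mul_xi {s : K} (hs : s ≠ 0) : (q s)⁻¹ * xi s N = s ^ (2 - 2 * (N : ℤ)) := by
  rw [xi, q, ← zpow_natCast s 2, ← zpow_neg, ← zpow_mul, ← zpow_add₀ hs]
  congr 1
  push_cast
  ring

/-- The image of PQ is a line, and its spanning vector is an eigenvector of R up to the flip. In row
a the off-diagonal terms of R telescope; what remains besides the constant s^(2 - 2N) = q^{-1}ξ
cancels against the diagonal term. -/
theorem R_mul_P_mul_Q {s : K} (hs : s ≠ 0) :
    R s N * (P K N * Q s N) = ((q s)⁻¹ * xi s N) • Q s N := by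
  ext ⟨a, b⟩ ⟨e, f⟩
  have hr : ∀ x y : Fin N, x = y.rev ↔ y = x.rev := fun x y => by rw [eq_comm, Fin.rev_eq_iff]
  have h1 : ∀ c d : Fin N, (P K N * Q s N) (c, d) (e, f)
      = if d = c.rev then (if f = e.rev then qbar s e c.rev else 0) else 0 := by
    intro c d
    rw [P_mul_apply, Q_apply]
    grind
  rw [Matrix.mul_apply, Matrix.smul_apply, Q_apply, Fintype.sum_prod_type]
  simp only [h1, mul_ite, mul_zero, Finset.sum_ite_eq', Finset.mem_univ, if_true]
  by_cases hf : f = e.rev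
  swap
  · simp [hf]
  by_cases hb : b = a.rev
  swap
  · rw [if_neg (by tauto), smul_zero]
    refine Finset.sum_eq_zero fun c _ => ?_
    rw [R_apply_of_ne s (by grind), zero_mul, ite_self]
  subst hf hb
  simp only [if_true, and_self]
  have hsum := sum_gt_bar2 hs a
  have h2 : ∀ c : Fin N, R s N (a, a.rev) (c, c.rev) * qbar s e c.rev
      = (if c = a then diagCoeff s a a.rev * qbar s e a.rev else 0)
        + (if c = a.rev then (if a < a.rev then (q s - (q s)⁻¹) * qbar s e a else 0) else 0)
        - qbar s e a * (if a < c then (q s - (q s)⁻¹) * s ^ (2 * bar2 c) else 0) := by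
    intro c
    rw [R_apply_rev, sub_mul, add_mul, ite_mul, ite_mul, ite_mul, zero_mul, mul_ite, mul_zero]
    congr 1
    · congr 1
      · by_cases h : a = c
        · subst h; simp
        · simp [h, Ne.symm h]
      · by_cases h : c = a.rev
        · subst h
          simp
        · simp [h]
    · congr 1
      have : qbar s c a * qbar s e c.rev = qbar s e a * s ^ (2 * bar2 c) := by
        simp only [qbar, bar2_rev, ← zpow_add₀ hs]
        congr 1
        ring
      linear_combination (q s - (q s)⁻¹) * this
  rw [Finset.sum_congr rfl fun c _ => h2 c, Finset.sum_sub_distrib, Finset.sum_add_distrib,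
    Finset.sum_ite_eq', Finset.sum_ite_eq', ← Finset.mul_sum, hsum]
  simp only [Finset.mem_univ, if_true]
  have h3 : qbar s e a.rev = qbar s e a * s ^ (2 * bar2 a) := by
    simp only [qbar, bar2_rev, ← zpow_add₀ hs]
    congr 1
    ring
  have h4 : s ^ (2 * bar2 a - 2) = s ^ (2 * bar2 a) * (q s)⁻¹ := by
    rw [q, ← zpow_natCast s 2, ← zpow_neg, ← zpow_add₀ hs]; congr 1
  rw [h3, h4, q_inv_mul_xi hs, smul_eq_mul]
  simp only [midDefect, diagCoeff, Fin.rev_rev, if_true]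
  rcases lt_trichotomy a a.rev with h | h | h
  · rw [if_neg h.ne, if_pos h, if_neg h.le.not_gt, if_neg h.ne']
    ring
  · rw [if_pos h, if_pos h, if_neg h.not_lt, if_neg h.not_gt, if_pos h.symm, bar2_eq_zero h]
    simp
    ring
  · rw [if_neg h.ne', if_neg h.le.not_gt, if_pos h]
    ring

theorem star_R_mul_apply {s : K} (hs : s ≠ 0) (M : Matrix (Fin N × Fin N) (Fin N × Fin N) K)
    (a b : Fin N) (y : Fin N × Fin N) :
    (star s (R s N) * M) (a, b) y = diagCoeff s a b * M (a, b) y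
      - (if a ≤ b then (q s - (q s)⁻¹) * M (b, a) y else 0)
      + (if b = a.rev then ∑ c : Fin N,
          if a ≤ c then (q s - (q s)⁻¹) * qbar s a c * M (c, c.rev) y else 0 else 0) := by
  rw [Matrix.mul_apply, Fintype.sum_prod_type]
  simp only [star_R_apply hs]
  generalize q s - (q s)⁻¹ = h
  simp only [add_mul, sub_mul, Finset.sum_add_distrib,
    Finset.sum_sub_distrib]
  congr 1
  · congr 1
    · rw [Finset.sum_eq_single a, Finset.sum_eq_single b]
      · simp
      · intro x _ hx
        simp [Ne.symm hx]
      · simp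
      · intro x _ hx
        simp [Ne.symm hx]
      · simp
    · rw [Finset.sum_eq_single b, Finset.sum_eq_single a]
      · simp
      · intro x _ hx
        simp [Ne.symm hx]
      · simp
      · intro x _ hx
        simp [Ne.symm hx]
      · simp
  · by_cases hb : b = a.rev
    · rw [if_pos hb]
      refine Finset.sum_congr rfl fun c _ => ?_
      rw [Finset.sum_eq_single c.rev]
      · simp [hb]
      · intro x _ hx
        simp [hx]
      · simp
    · simp [hb]

/-- The only hard block of R^{-1}R = 1: on the vectors e_a ⊗ e_{a'} the flip-type and Q-type terms
interact, and the cross terms form a geometric sum over an interval of indices. -/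
theorem star_R_mul_R_apply_rev {s : K} (hs : s ≠ 0) (a e : Fin N) :
    (star s (R s N) * R s N) (a, a.rev) (e, e.rev) = if a = e then 1 else 0 := by
  have hq := q_ne_zero hs
  rw [star_R_mul_apply hs, if_pos rfl]
  set h := q s - (q s)⁻¹ with hh
  -- The product of the two Q-type terms runs over a ≤ c < e. It is written as the sum over c < e
  -- minus the sum over c < min(a, e), so that `sum_lt_bar2` applies to both.
  have h1 : ∀ c : Fin N, (if a ≤ c then h * qbar s a c * R s N (c, c.rev) (e, e.rev) else 0)
      = (if c = e then (if a ≤ e then h * qbar s a e * diagCoeff s e e.rev else 0) else 0)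
        + (if c = e.rev then
            (if a ≤ e.rev ∧ e.rev < e then h * qbar s a e.rev * h else 0) else 0)
        - h * qbar s a e.rev * ((if c < e then h * s ^ (-2 * bar2 c) else 0)
            - (if c < e ∧ c < a then h * s ^ (-2 * bar2 c) else 0)) := by
    intro c
    have hx : qbar s a c * qbar s e c = qbar s a e.rev * s ^ (-2 * bar2 c) := by
      simp only [qbar, bar2_rev, ← zpow_add₀ hs]
      congr 1
      ring
    have hx' : h * qbar s a c * (h * qbar s e c)
        = h * qbar s a e.rev * (h * s ^ (-2 * bar2 c)) := by
      linear_combination h * h * hx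
    have hr : e = c.rev ↔ c = e.rev := by rw [eq_comm, Fin.rev_eq_iff]
    rw [R_apply_rev, ← hh, mul_sub, mul_add, mul_ite (c < e), hx']
    simp only [hr]
    by_cases hac : a ≤ c
    · rw [if_pos hac]
      by_cases hce : c = e
      · subst hce
        simp [hac]
        grind
      · by_cases hce' : c = e.rev
        · subst hce'
          simp [hac, hce, hac.not_gt]
        · simp [hce, hce', hac.not_gt]
    · rw [if_neg hac]
      by_cases hce : c = e
      · subst hce
        simp [hac]
        grind
      · by_cases hce' : c = e.rev
        · subst hce'
          simp [hac, hce, not_le.1 hac]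
        · simp [hce, hce', not_le.1 hac]
  rw [Finset.sum_congr rfl fun c _ => h1 c, Finset.sum_sub_distrib, Finset.sum_add_distrib,
    Finset.sum_ite_eq', Finset.sum_ite_eq', ← Finset.mul_sum, Finset.sum_sub_distrib,
    if_pos (Finset.mem_univ _), if_pos (Finset.mem_univ _)]
  rw [R_apply_rev, ← hh]
  have hr' := R_apply_rev s a.rev e
  rw [Fin.rev_rev] at hr'
  rw [hr', ← hh]
  rcases lt_trichotomy a e with hae | hae | hae
  · have hs1 : ∀ c : Fin N, (if c < e ∧ c < a then h * s ^ (-2 * bar2 c) else 0)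
        = if c < a then h * s ^ (-2 * bar2 c) else 0 := fun c => by grind
    have hG : ∀ i : Fin N, (∑ c : Fin N, if c < i then h * s ^ (-2 * bar2 c) else 0)
        = s ^ (-2 - 2 * bar2 i) - s ^ (2 - 2 * (N : ℤ)) + midDefect s i := sum_lt_bar2 hs
    simp only [hs1, hG]
    have e1 : qbar s a e = qbar s a e.rev * s ^ (-2 * bar2 e) := by
      simp only [qbar, bar2_rev, ← zpow_add₀ hs]; congr 1; ring
    have e2 : qbar s e a = qbar s a e.rev * s ^ (-2 * bar2 a) := by
      simp only [qbar, bar2_rev, ← zpow_add₀ hs]; congr 1; ring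
    have e3 : qbar s e a.rev = qbar s a e.rev := by
      simp only [qbar, bar2_rev]; congr 1; ring
    have e4 : ∀ i : Fin N, s ^ (-2 - 2 * bar2 i) = s ^ (-2 * bar2 i) * (q s)⁻¹ := by
      intro i
      rw [q, ← zpow_natCast s 2, ← zpow_neg, ← zpow_add₀ hs]; congr 1; push_cast; ring
    have e5 : ∀ i : Fin N, i = i.rev → s ^ (-2 * bar2 i) = 1 := fun i hi => by
      simp [bar2_eq_zero hi]
    rw [e1, e2, e3, e4, e4]
    generalize qbar s a e.rev = x
    have l1 := e5 a
    have l2 := e5 e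
    generalize s ^ (-2 * bar2 a) = y at *
    generalize s ^ (-2 * bar2 e) = z at *
    simp only [diagCoeff, midDefect, Fin.rev_rev]
    have hqi : q s * (q s)⁻¹ = 1 := mul_inv_cancel₀ hq
    rw [if_neg hae.ne, if_pos hae, if_neg (c := e = a ∧ _) (by grind), if_pos hae.le,
      if_neg (c := a = e) hae.ne]
    clear hr' hG hs1 h1 e1 e2 e3 e4 e5
    clear_value h
    generalize s ^ (2 - 2 * (N : ℤ)) = w
    generalize (q s)⁻¹ = p at *
    have m1 : a.rev < e ↔ e.rev < a := by simp only [Fin.lt_def, Fin.val_rev]; omega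
    have m2 : a ≤ e.rev ↔ e ≤ a.rev := by simp only [Fin.le_def, Fin.val_rev]; omega
    have m3 : a.rev = e ↔ e = a.rev := eq_comm
    have m4 : e.rev < a.rev := Fin.rev_lt_rev.2 hae
    simp only [m1, m2, m3]
    generalize a.rev = a' at *
    generalize e.rev = e' at *
    have m5 : a ≤ e' ↔ ¬ e' < a := not_lt.symm
    rcases lt_trichotomy a a' with ha | ha | ha <;>
      rcases lt_trichotomy e e' with he | he | he
    -- Here a lies before the middle and e after it, so the positions of e relative to a' and of e'
    -- relative to a must be distinguished as well.
    on_goal 3 =>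
      simp only [ha, he, ha.ne, ha.ne', he.ne', ha.le, he.not_gt, if_true, if_false, and_true,
        ← hh]
      simp only [← m2, m5]
      by_cases h1 : e = a' <;> by_cases h2 : e' < a <;> simp only [h1, h2, not_true, not_false_iff,
        if_true, if_false] <;> ring
    all_goals grind
  · subst hae
    simp only [and_self, sub_self, mul_zero, lt_irrefl, le_refl, if_true, if_false, qbar_self]
    simp only [diagCoeff]
    grind
  · have hs1 : ∀ c : Fin N, (if c < e ∧ c < a then h * s ^ (-2 * bar2 c) else 0)
        = if c < e then h * s ^ (-2 * bar2 c) else 0 := fun c => by grind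
    simp only [hs1, sub_self, mul_zero]
    grind

/-- Outside the block of the vectors e_a ⊗ e_{a'} the Q-type terms vanish, and only blocks of size
at most two, spanned by e_a ⊗ e_b and e_b ⊗ e_a, remain. -/
theorem star_R_mul_R {s : K} (hs : s ≠ 0) : star s (R s N) * R s N = 1 := by
  have hq := q_ne_zero hs
  ext ⟨a, b⟩ ⟨e, f⟩
  rw [Matrix.one_apply]
  by_cases hb : b = a.rev
  · subst hb
    by_cases hf : f = e.rev
    · subst hf
      rw [star_R_mul_R_apply_rev hs]
      simp
    · rw [star_R_mul_apply hs, R_apply_of_ne s (by simpa using hf),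
        R_apply_of_ne s (by simpa using hf), if_pos rfl, Finset.sum_eq_zero]
      · simp
        grind
      · intro c _
        rw [R_apply_of_ne s (by simpa using hf), mul_zero, ite_self]
  · have hb' : ¬ a = b.rev := fun h => hb (by rw [h, Fin.rev_rev])
    rw [star_R_mul_apply hs, R_apply, R_apply, if_neg hb]
    simp only [hb, hb', false_and, if_false, Prod.mk.injEq, diagCoeff, sub_zero, add_zero]
    rcases lt_trichotomy a b with h | h | h
    · grind
    · subst h
      grind
    · grind

end Products

/-- Crossing as pure algebra: each of the nine products is a combination of 1, pr and pe. The
coefficients of pr and pe cancel, the latter through the value of κ, and the coefficient of 1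
factorises. -/
theorem crossing_of_relations {F M : Type*} [CommRing F] [Ring M] [Algebra F M]
    {r r' p e e' : M} {q p₁ h l μ κ ξ x : F}
    (hq : q * p₁ = 1) (hh : h = q - p₁) (hl : l = p₁ * ξ) (hμ : μ * ξ = q)
    (hκ : h * κ * ξ = q - ξ ^ 2 * p₁ + h * ξ)
    (h1 : r' * r = 1) (h2 : r' * p = p * r - h • 1 + h • (p * e)) (h3 : r' * e = μ • (p * e))
    (h4 : e' * r = l • (p * e)) (h5 : e' * p = p * e) (h6 : e' * e = κ • (p * e))
    (h7 : p * p = 1) :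
    ((p₁ * (ξ * x - 1) * (ξ * x - ξ)) • r' - ((p₁ ^ 2 - 1) * (ξ * x - ξ)) • e'
        + ((p₁ ^ 2 - 1) * (ξ * x - 1) * ξ) • p)
      * ((p₁ * (x - 1) * (x - ξ)) • r - ((p₁ ^ 2 - 1) * (x - ξ)) • p
        + ((p₁ ^ 2 - 1) * (x - 1) * ξ) • e)
      = (ξ * p₁ ^ 2 * ((1 - q ^ 2 * x) * (1 - p₁ ^ 2 * x) * (1 - ξ * x) * (ξ - x))) • 1 := by
  simp only [add_mul, sub_mul, mul_add, mul_sub, smul_mul_smul_comm, h1, h2, h3, h4, h5, h6, h7]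
  match_scalars
  all_goals clear h1 h2 h3 h4 h5 h6 h7; subst hh hl
  all_goals grind

/-! ### Crossing symmetry of R(u). -/

section Series

variable {K : Type*} [Field K] {N : ℕ}

/-- The polynomial factor of `R(u)`. -/
noncomputable def Rpoly (s : K) (N : ℕ) : Matrix (Fin N × Fin N) (Fin N × Fin N) K⟦X⟧ :=
  (PowerSeries.C (q s)⁻¹ * (PowerSeries.X - 1) * (PowerSeries.X - PowerSeries.C (xi s N)))
      • const (R s N)
    - (PowerSeries.C ((q s)⁻¹ ^ 2 - 1) * (PowerSeries.X - PowerSeries.C (xi s N)))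
      • const (P K N)
    + (PowerSeries.C ((q s)⁻¹ ^ 2 - 1) * (PowerSeries.X - 1) * PowerSeries.C (xi s N))
      • const (Q s N)

theorem Rser_eq (s : K) : Rser s N = f s N • Rpoly s N := rfl

theorem const_mul (A B : Matrix (Fin N × Fin N) (Fin N × Fin N) K) :
    const (A * B) = const A * const B := Matrix.map_mul

theorem const_add (A B : Matrix (Fin N × Fin N) (Fin N × Fin N) K) :
    const (A + B) = const A + const B := Matrix.map_add _ (map_add _) _ _

theorem const_sub (A B : Matrix (Fin N × Fin N) (Fin N × Fin N) K) :
    const (A - B) = const A - const B := Matrix.map_sub _ (map_sub _) _ _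

theorem const_smul (c : K) (A : Matrix (Fin N × Fin N) (Fin N × Fin N) K) :
    const (c • A) = PowerSeries.C c • const A := by
  ext i j : 2
  simp [const]

theorem const_one : const (1 : Matrix (Fin N × Fin N) (Fin N × Fin N) K) = 1 :=
  Matrix.map_one _ (map_zero _) (map_one _)

theorem star_const (s : K) (A : Matrix (Fin N × Fin N) (Fin N × Fin N) K) :
    star s (const A) = const (star s A) := by
  ext i j : 2
  simp [const, star, PowerSeries.smul_eq_C_mul]

theorem star_add {F : Type*} [CommRing F] [Algebra K F] (s : K)
    (A B : Matrix (Fin N × Fin N) (Fin N × Fin N) F) : star s (A + B) = star s A + star s B := by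
  ext i j : 2
  simp [star]

theorem star_sub {F : Type*} [CommRing F] [Algebra K F] (s : K)
    (A B : Matrix (Fin N × Fin N) (Fin N × Fin N) F) : star s (A - B) = star s A - star s B := by
  ext i j : 2
  simp [star, smul_sub]

theorem star_smul {F : Type*} [CommRing F] [Algebra K F] (s : K) (g : F)
    (A : Matrix (Fin N × Fin N) (Fin N × Fin N) F) : star s (g • A) = g • star s A := by
  ext i j : 2
  simp [star]

theorem rescale_C (c a : K) : PowerSeries.rescale c (PowerSeries.C a) = PowerSeries.C a := by
  ext n
  rw [PowerSeries.coeff_rescale, PowerSeries.coeff_C]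
  split_ifs with h <;> simp [h]

theorem map_rescale_smul_const (c : K) (g : K⟦X⟧)
    (A : Matrix (Fin N × Fin N) (Fin N × Fin N) K) :
    (g • const A).map (PowerSeries.rescale c) = PowerSeries.rescale c g • const A := by
  ext i j : 2
  simp only [const, Matrix.map_apply, Matrix.smul_apply, smul_eq_mul, map_mul, rescale_C]

theorem Rpoly_map_rescale (s : K) :
    (Rpoly s N).map (PowerSeries.rescale (xi s N))
      = (PowerSeries.C (q s)⁻¹ * (PowerSeries.C (xi s N) * PowerSeries.X - 1)
            * (PowerSeries.C (xi s N) * PowerSeries.X - PowerSeries.C (xi s N))) • const (R s N)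
        - ((PowerSeries.C (q s)⁻¹ ^ 2 - 1)
            * (PowerSeries.C (xi s N) * PowerSeries.X - PowerSeries.C (xi s N))) • const (P K N)
        + ((PowerSeries.C (q s)⁻¹ ^ 2 - 1) * (PowerSeries.C (xi s N) * PowerSeries.X - 1)
            * PowerSeries.C (xi s N)) • const (Q s N) := by
  rw [Rpoly, Matrix.map_add _ (map_add _), Matrix.map_sub _ (map_sub _), map_rescale_smul_const,
    map_rescale_smul_const, map_rescale_smul_const]
  simp only [map_mul, map_sub, map_pow, map_one, rescale_C, PowerSeries.rescale_X]

theorem xi_ne_zero {s : K} (hs : s ≠ 0) : xi s N ≠ 0 := zpow_ne_zero _ (q_ne_zero hs)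

/-- The transpose of `R_mul_P_mul_Q`, since transposing R or Q amounts to conjugating by P. -/
theorem Q_conj_mul_R {s : K} (hs : s ≠ 0) :
    P K N * Q s N * P K N * R s N = ((q s)⁻¹ * xi s N) • (P K N * Q s N) := by
  have h := congrArg Matrix.transpose (R_mul_P_mul_Q (N := N) hs)
  rw [Matrix.transpose_mul, Matrix.transpose_mul, Matrix.transpose_smul, R_transpose, Q_transpose,
    P_transpose] at h
  have h1 := congrArg (· * P K N) h
  simp only [Matrix.smul_mul] at h1
  simpa [mul_assoc, P_mul_P, ← mul_assoc (P K N) (P K N)] using h1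

/-- Obtained from the eigenvalue relation by multiplying with R^{-1}, whence the reciprocal
eigenvalue. -/
theorem star_R_mul_Q {s : K} (hs : s ≠ 0) :
    star s (R s N) * Q s N = (q s * (xi s N)⁻¹) • (P K N * Q s N) := by
  have hq := q_ne_zero hs
  have hx : xi s N ≠ 0 := xi_ne_zero hs
  have h : star s (R s N) * (R s N * (P K N * Q s N)) = P K N * Q s N := by
    rw [← mul_assoc, star_R_mul_R hs, one_mul]
  rw [R_mul_P_mul_Q hs, Matrix.mul_smul] at h
  rw [← h, smul_smul]
  field_simp
  simp

theorem Q_conj_mul_Q {s : K} (hs : s ≠ 0) :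
    P K N * Q s N * P K N * Q s N = (∑ c : Fin N, s ^ (2 * bar2 c)) • (P K N * Q s N) := by
  rw [mul_assoc, mul_assoc, ← mul_assoc (Q s N), Q_mul_P_mul_Q hs, Matrix.mul_smul]

theorem crossing_Rpoly {s : K} (hs : s ≠ 0) (hN : 2 ≤ N) :
    star s ((Rpoly s N).map (PowerSeries.rescale (xi s N))) * Rpoly s N
      = (PowerSeries.C (xi s N) * PowerSeries.C (q s)⁻¹ ^ 2
          * ((1 - PowerSeries.C (q s) ^ 2 * PowerSeries.X)
            * (1 - PowerSeries.C (q s)⁻¹ ^ 2 * PowerSeries.X)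
            * (1 - PowerSeries.C (xi s N) * PowerSeries.X)
            * (PowerSeries.C (xi s N) - PowerSeries.X))) • 1 := by
  have hq := q_ne_zero hs
  have hx : xi s N ≠ 0 := xi_ne_zero hs
  rw [Rpoly_map_rescale]
  simp only [star_add, star_sub, star_smul, star_const, Rpoly, map_sub, map_one, map_pow,
    star_P, star_Q hs]
  refine crossing_of_relations (h := PowerSeries.C (q s - (q s)⁻¹))
    (l := PowerSeries.C ((q s)⁻¹ * xi s N)) (μ := PowerSeries.C (q s * (xi s N)⁻¹))
    (κ := PowerSeries.C (∑ c : Fin N, s ^ (2 * bar2 c))) ?_ (map_sub _ _ _) (map_mul _ _ _)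
    ?_ ?_ ?_ ?_ ?_ ?_ ?_ ?_ ?_
  · rw [← map_mul, mul_inv_cancel₀ hq, map_one]
  · rw [← map_mul, inv_mul_cancel_right₀ hx]
  · simp only [← map_mul, ← map_pow, ← map_sub, ← map_add]
    congr 1
    rw [sum_bar2 hs hN]
    have h1 : s ^ (2 * (N : ℤ) - 2) * xi s N = q s := by
      rw [xi, q, ← zpow_natCast s 2, ← zpow_mul, ← zpow_add₀ hs]; congr 1; push_cast; ring
    linear_combination h1 + xi s N * q_inv_mul_xi (N := N) hs
  · rw [← const_mul, star_R_mul_R hs, const_one]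
  · rw [← const_mul, star_R_mul_P hs]
    simp only [const_add, const_sub, const_smul, const_mul, const_one]
  · rw [← const_mul, star_R_mul_Q hs, const_smul, const_mul]
  · rw [← const_mul, Q_conj_mul_R hs, const_smul, const_mul]
  · rw [← const_mul, mul_assoc, P_mul_P, mul_one, const_mul]
  · rw [← const_mul, Q_conj_mul_Q hs, const_smul, const_mul]
  · rw [← const_mul, P_mul_P, const_one]

theorem fRHS_mul (s : K) :
    fRHS s N * ((1 - PowerSeries.C ((q s)⁻¹ ^ 2) * PowerSeries.X)
      * (1 - PowerSeries.C (q s ^ 2) * PowerSeries.X) * (1 - PowerSeries.C (xi s N) * PowerSeries.X)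
      * (1 - PowerSeries.C (xi s N)⁻¹ * PowerSeries.X)) = 1 := by
  rw [fRHS, PowerSeries.inv_mul_cancel]
  simp

/-- The product f(u) f(uξ) cancels the four linear factors left by `crossing_Rpoly`; one factor ξ
comes from ξ - u = ξ(1 - ξ^{-1}u). -/
theorem crossing_Rser {s : K} (hs : s ≠ 0) (hN : 2 ≤ N)
    (h : ∀ k : ℕ, 0 < k → 1 + xi s N ^ k ≠ 0) :
    star s ((Rser s N).map (PowerSeries.rescale (xi s N))) * Rser s N
      = PowerSeries.C (xi s N ^ 2 * (q s)⁻¹ ^ 2) • 1 := by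
  have hx : xi s N ≠ 0 := xi_ne_zero hs
  have h1 : (Rser s N).map (PowerSeries.rescale (xi s N))
      = PowerSeries.rescale (xi s N) (f s N) • (Rpoly s N).map (PowerSeries.rescale (xi s N)) := by
    ext i j : 2
    simp [Rser_eq]
  rw [h1, star_smul, Rser_eq, Matrix.smul_mul, Matrix.mul_smul, crossing_Rpoly hs hN, smul_smul,
    smul_smul, mul_comm (PowerSeries.rescale _ _), f_mul_rescale s N h]
  congr 1
  have h2 := fRHS_mul (N := N) s
  have h3 : PowerSeries.C (xi s N) * PowerSeries.C (xi s N)⁻¹ = (1 : K⟦X⟧) := by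
    rw [← map_mul, mul_inv_cancel₀ hx, map_one]
  simp only [map_pow, map_mul] at h2 ⊢
  have h4 : PowerSeries.C (xi s N) - PowerSeries.X
      = PowerSeries.C (xi s N) * (1 - PowerSeries.C (xi s N)⁻¹ * PowerSeries.X) := by
    linear_combination PowerSeries.X * h3
  rw [h4]
  linear_combination (PowerSeries.C (xi s N) ^ 2 * PowerSeries.C (q s)⁻¹ ^ 2) * h2

end Series

/-! ### Abstract fusion: z commutes with whatever passes through both of its factors. -/

section Fusion

variable {K B ι : Type*} [Field K] [Ring B] [Algebra K B] [Fintype ι] [DecidableEq ι]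

/-- One triple sum is evaluated twice. Contracting the two R factors directly gives γ w_b zx. Moving
x through L and then through Lξ, and contracting the two L factors before the R' factors, gives γ
w_b xz. The families R and R' may differ, as in the mixed relation; only their common constant γ
matters. -/
theorem commute_of_fusion_left (ρ : ι → ι) (w : ι → K) (γ : K) {Rξ R Rξ' R' Lξ L : ι → ι → B}
    {x z : B}
    (hRL : ∀ i j, ∑ d, R i d * L d j * x = ∑ d, x * L i d * R' d j)
    (hRLξ : ∀ i j, ∑ d, Rξ i d * Lξ d j * x = ∑ d, x * Lξ i d * Rξ' d j)
    (hc : ∀ i j k l, Commute (R i j) (Lξ k l)) (hc' : ∀ i j k l, Commute (Rξ' i j) (L k l))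
    (hz : ∀ a b, ∑ j, w j • (Lξ (ρ j) a * L j b) = if a = ρ b then w b • z else 0)
    (hR : ∀ a b, ∑ j, w j • (Rξ (ρ j) a * R j b) = if a = ρ b then (γ * w b) • 1 else 0)
    (hR' : ∀ a b, ∑ j, w j • (Rξ' (ρ j) a * R' j b) = if a = ρ b then (γ * w b) • 1 else 0)
    (b : ι) (hγ : γ ≠ 0) (hw : w b ≠ 0) : Commute z x := by
  have h1 : ∑ j, ∑ c, ∑ d, w j • (Rξ (ρ j) c * R j d * (Lξ c (ρ b) * L d b * x))
      = (γ * w b) • (z * x) := by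
    calc _ = ∑ c, ∑ d, (∑ j, w j • (Rξ (ρ j) c * R j d)) * (Lξ c (ρ b) * L d b * x) := by
          rw [Finset.sum_comm]
          refine Finset.sum_congr rfl fun c _ => ?_
          rw [Finset.sum_comm]
          refine Finset.sum_congr rfl fun d _ => ?_
          rw [Finset.sum_mul]
          exact Finset.sum_congr rfl fun j _ => (smul_mul_assoc _ _ _).symm
      _ = ∑ d, γ • (w d • (Lξ (ρ d) (ρ b) * L d b)) * x := by
          rw [Finset.sum_comm]
          refine Finset.sum_congr rfl fun d _ => ?_
          simp only [hR, ite_mul, zero_mul, Finset.sum_ite_eq', Finset.mem_univ, if_true,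
            smul_mul_assoc, one_mul, mul_smul]
      _ = _ := by
          rw [← Finset.sum_mul, ← Finset.smul_sum, hz, if_pos rfl, mul_smul, smul_mul_assoc,
            smul_mul_assoc]
  have h2 : ∑ j, ∑ c, ∑ d, w j • (Rξ (ρ j) c * R j d * (Lξ c (ρ b) * L d b * x))
      = (γ * w b) • (x * z) := by
    calc _ = ∑ j, ∑ c, w j • (Rξ (ρ j) c * Lξ c (ρ b) * ∑ d, R j d * L d b * x) := by
          refine Finset.sum_congr rfl fun j _ => Finset.sum_congr rfl fun c _ => ?_
          rw [Finset.mul_sum, Finset.smul_sum]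
          refine Finset.sum_congr rfl fun d _ => ?_
          congr 1
          simp only [mul_assoc]
          rw [← mul_assoc (R j d), (hc _ _ _ _).eq, mul_assoc]
      _ = ∑ j, ∑ d, w j • ((∑ c, Rξ (ρ j) c * Lξ c (ρ b) * x) * (L j d * R' d b)) := by
          refine Finset.sum_congr rfl fun j _ => ?_
          simp only [hRL, Finset.mul_sum, Finset.smul_sum, Finset.sum_mul]
          rw [Finset.sum_comm]
          simp only [mul_assoc]
      _ = ∑ c, ∑ d, x * (∑ j, w j • (Lξ (ρ j) c * L j d)) * (Rξ' c (ρ b) * R' d b) := by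
          simp only [hRLξ, Finset.mul_sum, Finset.smul_sum, Finset.sum_mul]
          rw [Finset.sum_comm]
          refine (Finset.sum_congr rfl fun d _ => Finset.sum_comm).trans ?_
          rw [Finset.sum_comm]
          refine Finset.sum_congr rfl fun c _ => Finset.sum_congr rfl fun d _ =>
            Finset.sum_congr rfl fun j _ => ?_
          rw [mul_smul_comm, smul_mul_assoc]
          congr 1
          simp only [mul_assoc]
          rw [← mul_assoc (Rξ' c (ρ b)), (hc' _ _ _ _).eq, mul_assoc]
      _ = ∑ d, x * z * (w d • (Rξ' (ρ d) (ρ b) * R' d b)) := by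
          rw [Finset.sum_comm]
          refine Finset.sum_congr rfl fun d _ => ?_
          simp only [hz, mul_ite, mul_zero, ite_mul, zero_mul, Finset.sum_ite_eq',
            Finset.mem_univ, if_true, mul_smul_comm, smul_mul_assoc]
      _ = _ := by
          rw [← Finset.mul_sum, hR', if_pos rfl, mul_smul_comm, mul_one]
  exact smul_right_injective B (mul_ne_zero hγ hw) (h1.symm.trans h2)

/-- The mirror version, for L in the second tensor factor: x now stands between R and L, and the two
L factors occur in the opposite order. -/
theorem commute_of_fusion_right (ρ : ι → ι) (v : ι → K) (γ : K) {R₁ R₂ R₁' R₂' L₁ L₂ : ι → ι → B}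
    {x z : B}
    (h₁ : ∀ i j, ∑ d, R₁ i d * x * L₁ d j = ∑ d, L₁ i d * x * R₁' d j)
    (h₂ : ∀ i j, ∑ d, R₂ i d * x * L₂ d j = ∑ d, L₂ i d * x * R₂' d j)
    (hc : ∀ i j k l, Commute (R₁ i j) (L₂ k l)) (hc' : ∀ i j k l, Commute (R₂' i j) (L₁ k l))
    (hz : ∀ a b, ∑ j, v j • (L₂ b j * L₁ a (ρ j)) = if a = ρ b then v b • z else 0)
    (hR : ∀ a b, ∑ j, v j • (R₁ a (ρ j) * R₂ b j) = if a = ρ b then (γ * v b) • 1 else 0)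
    (hR' : ∀ a b, ∑ j, v j • (R₁' a (ρ j) * R₂' b j) = if a = ρ b then (γ * v b) • 1 else 0)
    (b : ι) (hγ : γ ≠ 0) (hv : v b ≠ 0) : Commute z x := by
  have h1 : ∑ j, ∑ c, ∑ d, v j • (R₁ (ρ b) c * (R₂ b d * x * L₂ d j) * L₁ c (ρ j))
      = (γ * v b) • (x * z) := by
    calc _ = ∑ c, ∑ d, R₁ (ρ b) c * R₂ b d * x * ∑ j, v j • (L₂ d j * L₁ c (ρ j)) := by
          rw [Finset.sum_comm]
          refine Finset.sum_congr rfl fun c _ => ?_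
          rw [Finset.sum_comm]
          refine Finset.sum_congr rfl fun d _ => ?_
          rw [Finset.mul_sum]
          refine Finset.sum_congr rfl fun j _ => ?_
          rw [mul_smul_comm]
          simp only [mul_assoc]
      _ = ∑ d, v d • (R₁ (ρ b) (ρ d) * R₂ b d) * (x * z) := by
          rw [Finset.sum_comm]
          refine Finset.sum_congr rfl fun d _ => ?_
          simp only [hz, mul_ite, mul_zero, Finset.sum_ite_eq', Finset.mem_univ, if_true,
            mul_smul_comm, smul_mul_assoc, mul_assoc]
      _ = _ := by
          rw [← Finset.sum_mul, hR, if_pos rfl, smul_mul_assoc, one_mul]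
  have h2 : ∑ j, ∑ c, ∑ d, v j • (R₁ (ρ b) c * (R₂ b d * x * L₂ d j) * L₁ c (ρ j))
      = (γ * v b) • (z * x) := by
    calc _ = ∑ j, ∑ c, v j • (R₁ (ρ b) c * (∑ d, R₂ b d * x * L₂ d j) * L₁ c (ρ j)) := by
          simp only [Finset.mul_sum, Finset.sum_mul, Finset.smul_sum]
      _ = ∑ j, ∑ d, v j • (L₂ b d * (∑ c, R₁ (ρ b) c * x * L₁ c (ρ j)) * R₂' d j) := by
          refine Finset.sum_congr rfl fun j _ => ?_
          simp only [h₂, Finset.mul_sum, Finset.smul_sum, Finset.sum_mul]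
          rw [Finset.sum_comm]
          refine Finset.sum_congr rfl fun d _ => Finset.sum_congr rfl fun c _ => ?_
          congr 1
          simp only [mul_assoc]
          rw [← mul_assoc (R₁ _ _), (hc _ _ _ _).eq, (hc' _ _ _ _).eq, mul_assoc]
      _ = ∑ c, ∑ d, L₂ b d * L₁ (ρ b) c * x * (∑ j, v j • (R₁' c (ρ j) * R₂' d j)) := by
          simp only [h₁, Finset.mul_sum, Finset.smul_sum, Finset.sum_mul]
          rw [Finset.sum_comm]
          refine (Finset.sum_congr rfl fun d _ => Finset.sum_comm).trans ?_
          rw [Finset.sum_comm]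
          refine Finset.sum_congr rfl fun c _ => Finset.sum_congr rfl fun d _ =>
            Finset.sum_congr rfl fun j _ => ?_
          rw [mul_smul_comm]
          simp only [mul_assoc]
      _ = ∑ d, γ • (v d • (L₂ b d * L₁ (ρ b) (ρ d))) * x := by
          rw [Finset.sum_comm]
          refine Finset.sum_congr rfl fun d _ => ?_
          simp only [hR', mul_ite, mul_zero, Finset.sum_ite_eq', Finset.mem_univ, if_true,
            mul_smul_comm, smul_mul_assoc, mul_one, mul_smul]
      _ = _ := by
          rw [← Finset.sum_mul, ← Finset.smul_sum, hz, if_pos rfl, mul_smul, smul_mul_assoc,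
            smul_mul_assoc]
  exact smul_right_injective B (mul_ne_zero hγ hv) (h2.symm.trans h1)

end Fusion

/-! ### Substitution into series in two variables. -/

section Evaluation

variable {K H : Type*} [Field K] [Ring H] [Algebra K H]

/-- The substitution `g(X) ↦ g(t U)` into power series in `U`. -/
noncomputable def ev (t : H) : K⟦X⟧ →+* H⟦X⟧ where
  toFun g := PowerSeries.mk fun k => PowerSeries.coeff k g • t ^ k
  map_one' := by
    ext n
    rw [PowerSeries.coeff_mk, PowerSeries.coeff_one, PowerSeries.coeff_one]
    split_ifs with h <;> simp [h]
  map_zero' := by ext n; simp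
  map_add' g g' := by ext n; simp [add_smul]
  map_mul' g g' := by
    ext n
    rw [PowerSeries.coeff_mk, PowerSeries.coeff_mul, PowerSeries.coeff_mul, Finset.sum_smul]
    refine Finset.sum_congr rfl fun p hp => ?_
    rw [PowerSeries.coeff_mk, PowerSeries.coeff_mk, smul_mul_smul_comm, ← pow_add,
      Finset.HasAntidiagonal.mem_antidiagonal.1 hp]

theorem coeff_ev (t : H) (g : K⟦X⟧) (k : ℕ) :
    PowerSeries.coeff k (ev t g) = PowerSeries.coeff k g • t ^ k := by
  simp [ev]

theorem ev_rescale (t : H) (c : K) (g : K⟦X⟧) :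
    ev t (PowerSeries.rescale c g) = ev (c • t) g := by
  ext k
  rw [coeff_ev, coeff_ev, PowerSeries.coeff_rescale, smul_pow, smul_smul, mul_comm]

theorem ev_smul (t : H) (c : K) (g : K⟦X⟧) : ev t (c • g) = c • ev t g := by
  ext k
  simp [coeff_ev, mul_smul]

theorem commute_ev {t : H} (ht : ∀ x, Commute t x) (g : K⟦X⟧) (y : H⟦X⟧) :
    Commute (ev t g) y := by
  ext n
  rw [PowerSeries.coeff_mul, PowerSeries.coeff_mul, ← Finset.Nat.sum_antidiagonal_swap]
  refine Finset.sum_congr rfl fun p _ => ?_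
  simp only [Prod.fst_swap, Prod.snd_swap, coeff_ev, smul_mul_assoc, mul_smul_comm]
  rw [((ht _).pow_left _).eq]

variable {A : Type*} [Ring A] [Algebra K A]

theorem coeff_single_pow_mul (τ n : ℤ) (w : A) (k : ℕ) (y : HahnSeries ℤ A) :
    (HahnSeries.single τ w ^ k * y).coeff n = w ^ k * y.coeff (n - k * τ) := by
  rw [HahnSeries.single_pow]
  have := HahnSeries.coeff_single_mul_add (r := w ^ k) (x := y) (a := n - k * τ) (b := k • τ)
  rwa [nsmul_eq_mul, sub_add_cancel] at this

theorem coeff_ev_mul (τ n : ℤ) (w : A) (g : K⟦X⟧) (y : (HahnSeries ℤ A)⟦X⟧) (a : ℕ) :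
    (PowerSeries.coeff a (ev (HahnSeries.single τ w) g * y)).coeff n
      = ∑ k ∈ Finset.range (a + 1), PowerSeries.coeff k g
          • (w ^ k * (PowerSeries.coeff (a - k) y).coeff (n - k * τ)) := by
  rw [PowerSeries.coeff_mul, Finset.Nat.sum_antidiagonal_eq_sum_range_succ_mk, HahnSeries.coeff_sum]
  refine Finset.sum_congr rfl fun k _ => ?_
  rw [coeff_ev, smul_mul_assoc, HahnSeries.coeff_smul, coeff_single_pow_mul]

theorem commute_single {w : A} (hw : ∀ x, Commute w x) (τ : ℤ) (y : HahnSeries ℤ A) :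
    Commute (HahnSeries.single τ w) y := by
  ext n
  have h1 := HahnSeries.coeff_single_mul_add (r := w) (x := y) (a := n - τ) (b := τ)
  have h2 := HahnSeries.coeff_mul_single_add (r := w) (x := y) (a := n - τ) (b := τ)
  rw [sub_add_cancel] at h1 h2
  rw [h1, h2, (hw _).eq]

end Evaluation

/-! ### The exchange relations as identities of generating series. -/

section RLL

variable {K A : Type*} [Field K] [Ring A] [Algebra K A] {N : ℕ}

theorem kronecker_one_mul_one_kronecker_apply (M M' : Matrix (Fin N) (Fin N) A)
    (i k j l : Fin N) :
    ((M ⊗ₖ (1 : Matrix (Fin N) (Fin N) A)) * ((1 : Matrix (Fin N) (Fin N) A) ⊗ₖ M')) (i, k) (j, l)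
      = M i j * M' k l := by
  rw [Matrix.mul_apply, Fintype.sum_prod_type, Finset.sum_eq_single j, Finset.sum_eq_single k]
  · simp
  · intro x _ hx
    simp [Ne.symm hx]
  · simp
  · intro x _ hx
    simp [Matrix.one_apply, hx]
  · simp

theorem one_kronecker_mul_kronecker_one_apply (M M' : Matrix (Fin N) (Fin N) A)
    (i k j l : Fin N) :
    (((1 : Matrix (Fin N) (Fin N) A) ⊗ₖ M') * (M ⊗ₖ (1 : Matrix (Fin N) (Fin N) A))) (i, k) (j, l)
      = M' k l * M i j := by
  rw [Matrix.mul_apply, Fintype.sum_prod_type, Finset.sum_eq_single i, Finset.sum_eq_single l]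
  · simp
  · intro x _ hx
    simp [hx]
  · simp
  · intro x _ hx
    simp [Matrix.one_apply, Ne.symm hx]
  · simp

/-- The truncation bound may come from either generator matrix or from R; the last option serves the
polynomial `Rpoly`, whose bound 3 is uniform in a and b. -/
theorem rllLeft_apply (Rm : Matrix (Fin N × Fin N) (Fin N × Fin N) K⟦X⟧)
    (l : Sgn → Fin N → Fin N → ℕ → A) (w : A) (ε₁ ε₂ : Sgn) (a b : ℤ) (n : ℕ)
    (h : ∀ k : ℕ, n ≤ k →
      modeMat l ε₁ (a - k) = 0 ∨ modeMat l ε₂ (b + k) = 0 ∨ coeffMat A Rm k = 0)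
    (i i' j j' : Fin N) :
    rllLeft Rm l w ε₁ ε₂ a b (i, i') (j, j') = ∑ k ∈ Finset.range n, ∑ c, ∑ d,
      PowerSeries.coeff k (Rm (i, i') (c, d))
        • (w ^ k * (modeMat l ε₁ (a - k) c j * modeMat l ε₂ (b + k) d j')) := by
  have h1 : rllLeft Rm l w ε₁ ε₂ a b = ∑ k ∈ Finset.range n, w ^ k • (coeffMat A Rm k
      * (modeMat l ε₁ (a - k) ⊗ₖ (1 : Matrix (Fin N) (Fin N) A))
      * ((1 : Matrix (Fin N) (Fin N) A) ⊗ₖ modeMat l ε₂ (b + k))) := by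
    refine finsum_eq_sum_of_support_subset _ fun k hk => ?_
    by_contra hk'
    refine hk ?_
    rcases h k (by simpa using hk') with h | h | h <;> simp [h]
  rw [h1, Matrix.sum_apply]
  refine Finset.sum_congr rfl fun k _ => ?_
  rw [Matrix.smul_apply, mul_assoc, Matrix.mul_apply, Fintype.sum_prod_type]
  simp only [kronecker_one_mul_one_kronecker_apply, coeffMat, Matrix.map_apply, smul_eq_mul,
    Finset.mul_sum, ← Algebra.smul_def, mul_smul_comm]

theorem rllRight_apply (Rm : Matrix (Fin N × Fin N) (Fin N × Fin N) K⟦X⟧)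
    (l : Sgn → Fin N → Fin N → ℕ → A) (w : A) (ε₁ ε₂ : Sgn) (a b : ℤ) (n : ℕ)
    (h : ∀ k : ℕ, n ≤ k →
      modeMat l ε₁ (a - k) = 0 ∨ modeMat l ε₂ (b + k) = 0 ∨ coeffMat A Rm k = 0)
    (i i' j j' : Fin N) :
    rllRight Rm l w ε₁ ε₂ a b (i, i') (j, j') = ∑ k ∈ Finset.range n, ∑ c, ∑ d,
      PowerSeries.coeff k (Rm (c, d) (j, j'))
        • (w ^ k * (modeMat l ε₂ (b + k) i' d * modeMat l ε₁ (a - k) i c)) := by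
  have h1 : rllRight Rm l w ε₁ ε₂ a b = ∑ k ∈ Finset.range n,
      w ^ k • (((1 : Matrix (Fin N) (Fin N) A) ⊗ₖ modeMat l ε₂ (b + k))
        * (modeMat l ε₁ (a - k) ⊗ₖ (1 : Matrix (Fin N) (Fin N) A)) * coeffMat A Rm k) := by
    refine finsum_eq_sum_of_support_subset _ fun k hk => ?_
    by_contra hk'
    refine hk ?_
    rcases h k (by simpa using hk') with h | h | h <;> simp [h]
  rw [h1, Matrix.sum_apply]
  refine Finset.sum_congr rfl fun k _ => ?_
  rw [Matrix.smul_apply, Matrix.mul_apply, Fintype.sum_prod_type]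
  simp only [one_kronecker_mul_kronecker_one_apply, coeffMat, Matrix.map_apply, smul_eq_mul,
    Finset.mul_sum, ← Algebra.commutes, ← Algebra.smul_def, mul_smul_comm]

/-- The sign as an integer. -/
def Sgn.toInt : Sgn → ℤ
  | .plus => 1
  | .minus => -1

theorem modeMat_apply (l : Sgn → Fin N → Fin N → ℕ → A) (ε : Sgn) (m : ℤ) (i j : Fin N) :
    modeMat l ε m i j = if 0 ≤ ε.toInt * m then l ε i j m.natAbs else 0 := by
  cases ε
  · simp only [modeMat, Sgn.toInt, ite_zero_apply, Matrix.of_apply, one_mul]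
    refine ite_congr rfl (fun _ => ?_) fun _ => rfl
    congr 1
    omega
  · simp only [modeMat, Sgn.toInt, ite_zero_apply, Matrix.of_apply, neg_mul, one_mul, neg_nonneg]
    refine ite_congr rfl (fun _ => ?_) fun _ => rfl
    congr 1
    omega

theorem modeMat_eq_zero_of_neg (l : Sgn → Fin N → Fin N → ℕ → A) (ε : Sgn) {m : ℤ}
    (h : ε.toInt * m < 0) : modeMat l ε m = 0 := by
  ext i j
  rw [modeMat_apply, if_neg (by omega), Matrix.zero_apply]

theorem Sgn.toInt_mul_toInt (ε : Sgn) : ε.toInt * ε.toInt = 1 := by cases ε <;> rfl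

/-- The series `∑ c ^ m l^ε_{ij}[∓ m] U ^ m`, where `U = u ^ (± 1)`. -/
noncomputable def outerSer (l : Sgn → Fin N → Fin N → ℕ → A) (ε : Sgn) (c : K) (i j : Fin N) :
    (HahnSeries ℤ A)⟦X⟧ :=
  PowerSeries.map (HahnSeries.C : A →+* HahnSeries ℤ A)
    (PowerSeries.mk fun m => c ^ m • l ε i j m)

/-- The series `∑ l^ε_{ij}[∓ m] V ^ m`, where `V = v ^ (± 1)`, constant in `U`. -/
noncomputable def innerSer (l : Sgn → Fin N → Fin N → ℕ → A) (ε : Sgn) (i j : Fin N) :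
    (HahnSeries ℤ A)⟦X⟧ :=
  PowerSeries.C (HahnSeries.ofPowerSeries ℤ A (PowerSeries.mk fun m => l ε i j m))

theorem ofPowerSeries_coeff_eq_modeMat (l : Sgn → Fin N → Fin N → ℕ → A) (ε : Sgn)
    (i j : Fin N) (n : ℤ) :
    (HahnSeries.ofPowerSeries ℤ A (PowerSeries.mk fun m => l ε i j m)).coeff n
      = modeMat l ε (ε.toInt * n) i j := by
  have h : (HahnSeries.ofPowerSeries ℤ A (PowerSeries.mk fun m => l ε i j m)).coeff n
      = if 0 ≤ n then l ε i j n.toNat else 0 := by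
    split_ifs with hn
    · obtain ⟨m, rfl⟩ := Int.eq_ofNat_of_zero_le hn
      simp
    · rw [HahnSeries.ofPowerSeries_apply]
      refine HahnSeries.embDomain_of_notMem_range ?_
      rintro ⟨m, hm⟩
      simp at hm
      omega
  rw [h, modeMat_apply, ← mul_assoc, Sgn.toInt_mul_toInt, one_mul]
  split_ifs
  · congr 1
    cases ε <;> simp only [Sgn.toInt] <;> omega
  · rfl

theorem coeff_outerSer_mul_innerSer (l : Sgn → Fin N → Fin N → ℕ → A) (ε δ : Sgn) (c : K)
    (i j i' j' : Fin N) (m : ℕ) (n : ℤ) :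
    (PowerSeries.coeff m (outerSer l ε c i j * innerSer l δ i' j')).coeff n
      = c ^ m • (l ε i j m * modeMat l δ (δ.toInt * n) i' j') := by
  rw [outerSer, innerSer, PowerSeries.coeff_mul_C, PowerSeries.coeff_map, PowerSeries.coeff_mk,
    HahnSeries.C_apply, ← sub_zero n, ← zero_add (n - 0), HahnSeries.coeff_single_mul]
  simp [ofPowerSeries_coeff_eq_modeMat]

theorem coeff_innerSer_mul_outerSer (l : Sgn → Fin N → Fin N → ℕ → A) (ε δ : Sgn) (c : K)
    (i j i' j' : Fin N) (m : ℕ) (n : ℤ) :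
    (PowerSeries.coeff m (innerSer l δ i' j' * outerSer l ε c i j)).coeff n
      = c ^ m • (modeMat l δ (δ.toInt * n) i' j' * l ε i j m) := by
  rw [outerSer, innerSer, PowerSeries.coeff_C_mul, PowerSeries.coeff_map, PowerSeries.coeff_mk,
    HahnSeries.C_apply, HahnSeries.coeff_mul_single]
  simp [ofPowerSeries_coeff_eq_modeMat]

variable (Rm : Matrix (Fin N × Fin N) (Fin N × Fin N) K⟦X⟧) (l : Sgn → Fin N → Fin N → ℕ → A)

/-- With U = u and V = v^{±1} of sign δ, the ratio u/v is U V^{-δ}, which explains the exponent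
`-δ.toInt`. Negative powers of V occur, hence Hahn series as coefficients of the power series in U.
-/
theorem coeff_sum_ev_mul_left (w : A) (δ : Sgn) (c : K) (i k j k' : Fin N) (a : ℕ) (n : ℤ) :
    (PowerSeries.coeff a (∑ d, ∑ m, ev (HahnSeries.single (-δ.toInt) (c • w)) (Rm (i, k) (d, m))
        * outerSer l .plus c d j * innerSer l δ m k')).coeff n
      = c ^ a • rllLeft Rm l w .plus δ a (δ.toInt * n) (i, k) (j, k') := by
  rw [rllLeft_apply Rm l w .plus δ a (δ.toInt * n) (a + 1) (fun k hk => Or.inl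
    (modeMat_eq_zero_of_neg l _ (by simp only [Sgn.toInt]; omega)))]
  simp only [map_sum, HahnSeries.coeff_sum, mul_assoc, coeff_ev_mul, Finset.smul_sum]
  refine (Finset.sum_congr rfl fun d _ => Finset.sum_comm).trans ?_
  rw [Finset.sum_comm]
  refine Finset.sum_congr rfl fun κ hκ => Finset.sum_congr rfl fun d _ =>
    Finset.sum_congr rfl fun m _ => ?_
  have hκ' : κ ≤ a := Nat.lt_succ_iff.1 (Finset.mem_range.1 hκ)
  rw [coeff_outerSer_mul_innerSer, modeMat_apply l .plus, if_pos (by simp only [Sgn.toInt]; omega),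
    show ((a : ℤ) - κ).natAbs = a - κ by omega, smul_pow, smul_mul_smul_comm, ← pow_add,
    Nat.add_sub_cancel' hκ', smul_comm,
    show δ.toInt * (n - κ * -δ.toInt) = δ.toInt * n + κ by
      linear_combination (κ : ℤ) * δ.toInt_mul_toInt]

theorem coeff_sum_mul_ev_left (w : A) (hw : ∀ x, Commute w x) (δ : Sgn) (c : K)
    (i k j k' : Fin N) (a : ℕ) (n : ℤ) :
    (PowerSeries.coeff a (∑ d, ∑ m, innerSer l δ k m * outerSer l .plus c i d
        * ev (HahnSeries.single (-δ.toInt) (c • w)) (Rm (d, m) (j, k')))).coeff n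
      = c ^ a • rllRight Rm l w .plus δ a (δ.toInt * n) (i, k) (j, k') := by
  have hc : ∀ (g : K⟦X⟧) (y : (HahnSeries ℤ A)⟦X⟧),
      Commute (ev (HahnSeries.single (-δ.toInt) (c • w)) g : (HahnSeries ℤ A)⟦X⟧) y :=
    fun g y => commute_ev (commute_single (fun x => (hw x).smul_left c) _) g y
  rw [rllRight_apply Rm l w .plus δ a (δ.toInt * n) (a + 1) (fun k hk => Or.inl
    (modeMat_eq_zero_of_neg l _ (by simp only [Sgn.toInt]; omega)))]
  simp only [← (hc _ _).eq, map_sum, HahnSeries.coeff_sum, coeff_ev_mul, Finset.smul_sum]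
  refine (Finset.sum_congr rfl fun d _ => Finset.sum_comm).trans ?_
  rw [Finset.sum_comm]
  refine Finset.sum_congr rfl fun κ hκ => Finset.sum_congr rfl fun d _ =>
    Finset.sum_congr rfl fun m _ => ?_
  have hκ' : κ ≤ a := Nat.lt_succ_iff.1 (Finset.mem_range.1 hκ)
  rw [coeff_innerSer_mul_outerSer, modeMat_apply l .plus, if_pos (by simp only [Sgn.toInt]; omega),
    show ((a : ℤ) - κ).natAbs = a - κ by omega, smul_pow, smul_mul_smul_comm, ← pow_add,
    Nat.add_sub_cancel' hκ', smul_comm,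
    show δ.toInt * (n - κ * -δ.toInt) = δ.toInt * n + κ by
      linear_combination (κ : ℤ) * δ.toInt_mul_toInt]

/-- Here U = u^{-1} belongs to the second tensor factor and the argument of R is v/u = V^δ U, so the
exponent is `δ.toInt`. -/
theorem coeff_sum_ev_mul_right (w : A) (δ : Sgn) (c : K) (i k j k' : Fin N) (b : ℕ) (n : ℤ) :
    (PowerSeries.coeff b (∑ d, ∑ m, ev (HahnSeries.single δ.toInt (c • w)) (Rm (k, i) (m, d))
        * innerSer l δ m k' * outerSer l .minus c d j)).coeff n
      = c ^ b • rllLeft Rm l w δ .minus (δ.toInt * n) (-b) (k, i) (k', j) := by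
  rw [rllLeft_apply Rm l w δ .minus (δ.toInt * n) (-b) (b + 1) (fun k hk => Or.inr <| Or.inl
    (modeMat_eq_zero_of_neg l _ (by simp only [Sgn.toInt]; omega)))]
  simp only [map_sum, HahnSeries.coeff_sum, mul_assoc, coeff_ev_mul, Finset.smul_sum]
  refine (Finset.sum_congr rfl fun d _ => Finset.sum_comm).trans ?_
  rw [Finset.sum_comm]
  refine Finset.sum_congr rfl fun κ hκ => ?_
  rw [Finset.sum_comm]
  refine Finset.sum_congr rfl fun m _ => Finset.sum_congr rfl fun d _ => ?_
  have hκ' : κ ≤ b := Nat.lt_succ_iff.1 (Finset.mem_range.1 hκ)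
  rw [coeff_innerSer_mul_outerSer, modeMat_apply l .minus,
    if_pos (by simp only [Sgn.toInt]; omega),
    show (-(b : ℤ) + κ).natAbs = b - κ by omega, smul_pow, smul_mul_smul_comm, ← pow_add,
    Nat.add_sub_cancel' hκ', smul_comm,
    show δ.toInt * (n - κ * δ.toInt) = δ.toInt * n - κ by
      linear_combination -(κ : ℤ) * δ.toInt_mul_toInt]

theorem coeff_sum_mul_ev_right (w : A) (hw : ∀ x, Commute w x) (δ : Sgn) (c : K)
    (i k j k' : Fin N) (b : ℕ) (n : ℤ) :
    (PowerSeries.coeff b (∑ d, ∑ m, outerSer l .minus c i d * innerSer l δ k m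
        * ev (HahnSeries.single δ.toInt (c • w)) (Rm (m, d) (k', j)))).coeff n
      = c ^ b • rllRight Rm l w δ .minus (δ.toInt * n) (-b) (k, i) (k', j) := by
  have hc : ∀ (g : K⟦X⟧) (y : (HahnSeries ℤ A)⟦X⟧),
      Commute (ev (HahnSeries.single δ.toInt (c • w)) g : (HahnSeries ℤ A)⟦X⟧) y :=
    fun g y => commute_ev (commute_single (fun x => (hw x).smul_left c) _) g y
  rw [rllRight_apply Rm l w δ .minus (δ.toInt * n) (-b) (b + 1) (fun k hk => Or.inr <| Or.inl
    (modeMat_eq_zero_of_neg l _ (by simp only [Sgn.toInt]; omega)))]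
  simp only [← (hc _ _).eq, map_sum, HahnSeries.coeff_sum, coeff_ev_mul, Finset.smul_sum]
  refine (Finset.sum_congr rfl fun d _ => Finset.sum_comm).trans ?_
  rw [Finset.sum_comm]
  refine Finset.sum_congr rfl fun κ hκ => ?_
  rw [Finset.sum_comm]
  refine Finset.sum_congr rfl fun m _ => Finset.sum_congr rfl fun d _ => ?_
  have hκ' : κ ≤ b := Nat.lt_succ_iff.1 (Finset.mem_range.1 hκ)
  rw [coeff_outerSer_mul_innerSer, modeMat_apply l .minus,
    if_pos (by simp only [Sgn.toInt]; omega),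
    show (-(b : ℤ) + κ).natAbs = b - κ by omega, smul_pow, smul_mul_smul_comm, ← pow_add,
    Nat.add_sub_cancel' hκ', smul_comm,
    show δ.toInt * (n - κ * δ.toInt) = δ.toInt * n - κ by
      linear_combination -(κ : ℤ) * δ.toInt_mul_toInt]

end RLL

/-! ### Removing an invertible scalar factor from R. -/

section Cancel

variable {K A : Type*} [Field K] [Ring A] [Algebra K A] {N : ℕ}
  (Rm : Matrix (Fin N × Fin N) (Fin N × Fin N) K⟦X⟧) (l : Sgn → Fin N → Fin N → ℕ → A)

/-- The relation `R(u w / v) L_1(u c) L_2(v) = L_2(v) L_1(u c) R(u w' / v)`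
as an identity of series in `u` with coefficients that are series in `v ^ (± 1)`. -/
theorem sum_ev_mul_left_eq {w w' : A} (hw' : ∀ x, Commute w' x) {δ : Sgn}
    (h : ∀ a b x y, rllLeft Rm l w .plus δ a b x y = rllRight Rm l w' .plus δ a b x y)
    (c : K) (i k j k' : Fin N) :
    ∑ d, ∑ m, ev (HahnSeries.single (-δ.toInt) (c • w)) (Rm (i, k) (d, m))
        * outerSer l .plus c d j * innerSer l δ m k'
      = ∑ d, ∑ m, innerSer l δ k m * outerSer l .plus c i d
        * ev (HahnSeries.single (-δ.toInt) (c • w')) (Rm (d, m) (j, k')) := by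
  refine PowerSeries.ext fun a => HahnSeries.ext (funext fun n => ?_)
  rw [coeff_sum_ev_mul_left, coeff_sum_mul_ev_left _ _ _ hw', h]

/-- The relation `R(v w / (u c)) L_1(v) L_2(u c) = L_2(u c) L_1(v) R(v w' / (u c))`
as an identity of series in `u⁻¹` with coefficients that are series in `v ^ (± 1)`. -/
theorem sum_ev_mul_right_eq {w w' : A} (hw' : ∀ x, Commute w' x) {δ : Sgn}
    (h : ∀ a b x y, rllLeft Rm l w δ .minus a b x y = rllRight Rm l w' δ .minus a b x y)
    (c : K) (i k j k' : Fin N) :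
    ∑ d, ∑ m, ev (HahnSeries.single δ.toInt (c • w)) (Rm (k, i) (m, d))
        * innerSer l δ m k' * outerSer l .minus c d j
      = ∑ d, ∑ m, outerSer l .minus c i d * innerSer l δ k m
        * ev (HahnSeries.single δ.toInt (c • w')) (Rm (m, d) (k', j)) := by
  refine PowerSeries.ext fun a => HahnSeries.ext (funext fun n => ?_)
  rw [coeff_sum_ev_mul_right, coeff_sum_mul_ev_right _ _ _ hw', h]

/-- As generating series both sides carry the same central factor g(u/v), which is invertible;
coefficients are then read off again. -/
theorem rllLeft_eq_rllRight_of_smul {g g' : K⟦X⟧} (hg : g' * g = 1) (ε : Sgn)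
    (h : ∀ a b x y, rllLeft (g • Rm) l 1 ε ε a b x y = rllRight (g • Rm) l 1 ε ε a b x y)
    (a b : ℤ) (x y : Fin N × Fin N) :
    rllLeft Rm l 1 ε ε a b x y = rllRight Rm l 1 ε ε a b x y := by
  obtain ⟨i, k⟩ := x
  obtain ⟨j, k'⟩ := y
  have h1 : ∀ x : A, Commute 1 x := Commute.one_left
  have hev : ∀ (t : HahnSeries ℤ A), ev t g' * ev t g = (1 : (HahnSeries ℤ A)⟦X⟧) :=
    fun t => by rw [← map_mul, hg, map_one]
  have hc : ∀ (n : ℤ) (p : K⟦X⟧) (y : (HahnSeries ℤ A)⟦X⟧),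
      Commute (ev (HahnSeries.single n ((1 : K) • (1 : A))) p) y :=
    fun n p y => commute_ev (commute_single (by simp) n) p y
  cases ε with
  | plus =>
    -- The generating series in u contain only exponents a ≥ 0; for negative a both coefficients
    -- vanish.
    rcases lt_or_ge a 0 with ha | ha
    · have h0 : ∀ k : ℕ, 0 ≤ k → modeMat l .plus (a - k) = 0 ∨ modeMat l .plus (b + k) = 0 ∨
          coeffMat A Rm k = 0 :=
        fun k _ => Or.inl (modeMat_eq_zero_of_neg l _ (by simp only [Sgn.toInt]; omega))
      rw [rllLeft_apply Rm l _ _ _ _ _ 0 h0, rllRight_apply Rm l _ _ _ _ _ 0 h0]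
      simp
    obtain ⟨a, rfl⟩ := Int.eq_ofNat_of_zero_le ha
    have hS := sum_ev_mul_left_eq (g • Rm) l h1 h 1 i k j k'
    simp only [Matrix.smul_apply, smul_eq_mul, map_mul, ← mul_assoc, ← (hc _ g _).eq] at hS
    replace hS := congrArg (fun y => ev (HahnSeries.single (-Sgn.plus.toInt) ((1 : K) • (1 : A))) g' * y) hS
    simp only [Finset.mul_sum, ← mul_assoc, hev, one_mul] at hS
    have := congrArg (fun y => (PowerSeries.coeff a y).coeff b) hS
    simp only [coeff_sum_ev_mul_left, coeff_sum_mul_ev_left _ _ _ h1] at this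
    simpa [Sgn.toInt] using this
  | minus =>
    rcases lt_or_ge 0 b with ha | ha
    · have h0 : ∀ k : ℕ, 0 ≤ k → modeMat l .minus (a - k) = 0 ∨ modeMat l .minus (b + k) = 0 ∨
          coeffMat A Rm k = 0 :=
        fun k _ => Or.inr <| Or.inl (modeMat_eq_zero_of_neg l _ (by simp only [Sgn.toInt]; omega))
      rw [rllLeft_apply Rm l _ _ _ _ _ 0 h0, rllRight_apply Rm l _ _ _ _ _ 0 h0]
      simp
    obtain ⟨b, rfl⟩ := Int.exists_eq_neg_ofNat ha
    have hS := sum_ev_mul_right_eq (g • Rm) l h1 h 1 k i k' j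
    simp only [Matrix.smul_apply, smul_eq_mul, map_mul, ← mul_assoc, ← (hc _ g _).eq] at hS
    replace hS := congrArg (fun y => ev (HahnSeries.single Sgn.minus.toInt ((1 : K) • (1 : A))) g' * y) hS
    simp only [Finset.mul_sum, ← mul_assoc, hev, one_mul] at hS
    have := congrArg (fun y => (PowerSeries.coeff b y).coeff (-a)) hS
    simp only [coeff_sum_ev_mul_right, coeff_sum_mul_ev_right _ _ _ h1] at this
    simpa [Sgn.toInt] using this

end Cancel

/-! ### The substitution u = vξ and the series z. -/

section Specialization

variable {K A : Type*} [Field K] [Ring A] [Algebra K A] {N : ℕ}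

/-- A formal power series cannot be evaluated at ξ, so the entries are lifted to polynomials of
degree at most 2. -/
theorem exists_polynomial_Rpoly (s : K) (x y : Fin N × Fin N) :
    ∃ p : Polynomial K, p.natDegree < 3 ∧ (p : K⟦X⟧) = Rpoly s N x y ∧
      p.eval (xi s N) = ((q s)⁻¹ ^ 2 - 1) * (xi s N - 1) * xi s N * Q s N x y := by
  refine ⟨Polynomial.C (q s)⁻¹ * (Polynomial.X - 1) * (Polynomial.X - Polynomial.C (xi s N))
      * Polynomial.C (R s N x y)
    - Polynomial.C ((q s)⁻¹ ^ 2 - 1) * (Polynomial.X - Polynomial.C (xi s N))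
      * Polynomial.C (P K N x y)
    + Polynomial.C ((q s)⁻¹ ^ 2 - 1) * (Polynomial.X - 1) * Polynomial.C (xi s N)
      * Polynomial.C (Q s N x y), ?_, ?_, ?_⟩
  · refine Nat.lt_succ_iff.2 ?_
    compute_degree
  · simp only [Polynomial.coe_add, Polynomial.coe_sub, Polynomial.coe_mul, Polynomial.coe_C,
      Polynomial.coe_X, Polynomial.coe_one]
    simp [Rpoly, const]
  · simp

theorem sum_coeff_Rpoly (s : K) (x y : Fin N × Fin N) :
    ∑ k ∈ Finset.range 3, PowerSeries.coeff k (Rpoly s N x y) * xi s N ^ k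
      = ((q s)⁻¹ ^ 2 - 1) * (xi s N - 1) * xi s N * Q s N x y := by
  obtain ⟨p, hp, hp1, hp2⟩ := exists_polynomial_Rpoly s x y
  rw [← hp2, Polynomial.eval_eq_sum_range' hp, ← hp1]
  simp

theorem coeff_Rpoly (s : K) (x y : Fin N × Fin N) {k : ℕ} (hk : 3 ≤ k) :
    PowerSeries.coeff k (Rpoly s N x y) = 0 := by
  obtain ⟨p, hp, hp1, -⟩ := exists_polynomial_Rpoly s x y
  rw [← hp1, Polynomial.coeff_coe, Polynomial.coeff_eq_zero_of_natDegree_lt (by omega)]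

/-- The coefficient sum obtained from `∑ c_k F(a - k) x ^ k`, summed over all `a` with weight
`ξ ^ a`. -/
theorem finsum_zpow_smul_shift {ξ : K} (hξ : ξ ≠ 0) {ι : Type*} (t : Finset ι) (n : ℕ)
    (c : ℕ → ι → K) (F : ι → ℤ → A) (hF : ∀ i, (Function.support (F i)).Finite) :
    ∑ᶠ a : ℤ, ξ ^ a • ∑ k ∈ Finset.range n, ∑ i ∈ t, c k i • F i (a - k)
      = ∑ i ∈ t, (∑ k ∈ Finset.range n, c k i * ξ ^ k) • ∑ᶠ a : ℤ, ξ ^ a • F i a := by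
  have hfin : ∀ (k : ℕ) (i : ι) (r : ℤ → K),
      (Function.support fun a : ℤ => r a • F i (a - k)).Finite := by
    intro k i r
    refine ((hF i).preimage (Equiv.subRight (k : ℤ)).injective.injOn).subset fun a ha h0 => ha ?_
    have h0' : F i (a - k) = 0 := h0
    simp [h0']
  have hterm : ∀ (k : ℕ) (i : ι), ∑ᶠ a : ℤ, (ξ ^ a * c k i) • F i (a - k)
      = (c k i * ξ ^ k) • ∑ᶠ a : ℤ, ξ ^ a • F i a := by
    intro k i
    rw [smul_finsum, ← finsum_comp_equiv (Equiv.subRight (k : ℤ))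
      (f := fun a => (c k i * ξ ^ k) • ξ ^ a • F i a)]
    refine finsum_congr fun a => ?_
    rw [Equiv.subRight_apply, smul_smul]
    congr 1
    rw [mul_assoc, ← zpow_natCast ξ k, ← zpow_add₀ hξ, add_sub_cancel, mul_comm]
  simp only [Finset.smul_sum, smul_smul]
  rw [finsum_sum_comm]
  · rw [Finset.sum_congr rfl fun k _ => finsum_sum_comm t _ fun i _ => hfin k i _,
      Finset.sum_comm]
    refine Finset.sum_congr rfl fun i _ => ?_
    rw [Finset.sum_smul]
    exact Finset.sum_congr rfl fun k _ => hterm k i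
  · intro k _
    refine (Set.Finite.biUnion t.finite_toSet fun i _ => hfin k i fun a => ξ ^ a * c k i).subset ?_
    intro a ha
    by_contra h
    refine ha (Finset.sum_eq_zero fun i hi => ?_)
    by_contra h'
    exact h (Set.mem_biUnion hi h')

/-- The series `l^ε_{ij}(u c)` in the formal variable `u ^ (± 1)`. -/
noncomputable def lSer (l : Sgn → Fin N → Fin N → ℕ → A) (ε : Sgn) (c : K) (i j : Fin N) : A⟦X⟧ :=
  PowerSeries.mk fun m => (ε.act c) ^ m • l ε i j m

theorem support_modeMat_finite (l : Sgn → Fin N → Fin N → ℕ → A) (ε : Sgn) (m : ℤ)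
    (i j i' j' : Fin N) :
    (Function.support fun a : ℤ => modeMat l ε a i j * modeMat l ε (m - a) i' j').Finite := by
  refine (Set.finite_Icc (-(m.natAbs : ℤ)) m.natAbs).subset fun a ha => ?_
  by_contra h
  refine ha ?_
  change modeMat l ε a i j * modeMat l ε (m - a) i' j' = 0
  have : ε.toInt * a < 0 ∨ ε.toInt * (m - a) < 0 := by
    cases ε <;> simp only [Sgn.toInt, Set.mem_Icc] at h ⊢ <;> omega
  rcases this with h | h <;> simp [modeMat_eq_zero_of_neg l ε h]

theorem support_modeMat_finite' (l : Sgn → Fin N → Fin N → ℕ → A) (ε : Sgn) (m : ℤ)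
    (i j i' j' : Fin N) :
    (Function.support fun a : ℤ => modeMat l ε (m - a) i' j' * modeMat l ε a i j).Finite := by
  have h := (support_modeMat_finite l ε m i' j' i j).preimage
    (f := fun a : ℤ => m - a) (sub_right_injective (b := m)).injOn
  refine h.subset fun a ha => ?_
  simpa using ha

theorem finsum_eq_sum_antidiagonal (ε : Sgn) (m : ℕ) (F : ℤ → ℤ → A)
    (hF : ∀ a b, ε.toInt * a < 0 ∨ ε.toInt * b < 0 → F a b = 0) :
    ∑ᶠ a : ℤ, F a (ε.toInt * m - a)
      = ∑ p ∈ Finset.HasAntidiagonal.antidiagonal m, F (ε.toInt * p.1) (ε.toInt * p.2) := by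
  have hinj : Function.Injective fun k : ℕ => ε.toInt * (k : ℤ) := by
    intro k k' h
    cases ε <;> simp [Sgn.toInt] at h <;> exact h
  rw [finsum_eq_sum_of_support_subset (s := (Finset.range (m + 1)).map ⟨_, hinj⟩),
    Finset.sum_map, Finset.Nat.sum_antidiagonal_eq_sum_range_succ_mk]
  · refine Finset.sum_congr rfl fun k hk => ?_
    have : k ≤ m := Nat.lt_succ_iff.1 (Finset.mem_range.1 hk)
    simp only [Function.Embedding.coeFn_mk]
    congr 1
    push_cast [this]
    ring
  · intro a ha
    by_contra h
    refine ha (hF _ _ ?_)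
    by_contra h'
    rw [not_or, not_lt, not_lt] at h'
    refine h (Finset.mem_coe.2 (Finset.mem_map.2 ⟨a.natAbs, ?_, ?_⟩))
    · rw [Finset.mem_range]
      cases ε <;> simp only [Sgn.toInt] at h' <;> omega
    · simp only [Function.Embedding.coeFn_mk]
      cases ε <;> simp only [Sgn.toInt] at h' ⊢ <;> omega

theorem act_pow_eq_zpow (ε : Sgn) (c : K) (k : ℕ) : ε.act c ^ k = c ^ (ε.toInt * k) := by
  cases ε <;> simp [Sgn.act, Sgn.toInt]

theorem modeMat_toInt_mul (l : Sgn → Fin N → Fin N → ℕ → A) (ε : Sgn) (k : ℕ) (i j : Fin N) :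
    modeMat l ε (ε.toInt * k) i j = l ε i j k := by
  rw [modeMat_apply, ← mul_assoc, Sgn.toInt_mul_toInt, one_mul, if_pos (by omega)]
  congr 1
  cases ε <;> simp [Sgn.toInt]

theorem finsum_modeMat_mul (l : Sgn → Fin N → Fin N → ℕ → A) (ε : Sgn) (c : K) (m : ℕ)
    (i j i' j' : Fin N) :
    ∑ᶠ a : ℤ, c ^ a • (modeMat l ε a i j * modeMat l ε (ε.toInt * m - a) i' j')
      = PowerSeries.coeff m (lSer l ε c i j * lSer l ε (1 : K) i' j') := by
  rw [finsum_eq_sum_antidiagonal ε m fun a b => c ^ a • (modeMat l ε a i j * modeMat l ε b i' j'),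
    PowerSeries.coeff_mul]
  · refine Finset.sum_congr rfl fun p _ => ?_
    simp only [modeMat_toInt_mul, lSer, PowerSeries.coeff_mk, act_pow_eq_zpow, one_zpow, one_smul,
      smul_mul_assoc]
  · rintro a b (h | h) <;> simp [modeMat_eq_zero_of_neg l ε h]

theorem finsum_modeMat_mul' (l : Sgn → Fin N → Fin N → ℕ → A) (ε : Sgn) (c : K) (m : ℕ)
    (i j i' j' : Fin N) :
    ∑ᶠ a : ℤ, c ^ a • (modeMat l ε (ε.toInt * m - a) i' j' * modeMat l ε a i j)
      = PowerSeries.coeff m (lSer l ε (1 : K) i' j' * lSer l ε c i j) := by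
  rw [finsum_eq_sum_antidiagonal ε m fun a b => c ^ a • (modeMat l ε b i' j' * modeMat l ε a i j),
    PowerSeries.coeff_mul, ← Finset.Nat.sum_antidiagonal_swap]
  · refine Finset.sum_congr rfl fun p _ => ?_
    simp only [modeMat_toInt_mul, lSer, PowerSeries.coeff_mk, act_pow_eq_zpow, one_zpow, one_smul,
      mul_smul_comm, Prod.fst_swap, Prod.snd_swap]
  · rintro a b (h | h) <;> simp [modeMat_eq_zero_of_neg l ε h]

/-- `Q L_1(v ξ) L_2(v) = L_2(v) L_1(v ξ) Q`. -/
theorem sum_Q_mul_lSer {s : K} (hs : s ≠ 0) (hq : (q s)⁻¹ ^ 2 ≠ 1) (hξ : xi s N ≠ 1)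
    (l : Sgn → Fin N → Fin N → ℕ → A) (ε : Sgn)
    (h : ∀ a b x y, rllLeft (Rpoly s N) l 1 ε ε a b x y = rllRight (Rpoly s N) l 1 ε ε a b x y)
    (i i' j j' : Fin N) :
    ∑ c, ∑ d, Q s N (i, i') (c, d) • (lSer l ε (xi s N) c j * lSer l ε (1 : K) d j')
      = ∑ c, ∑ d, Q s N (c, d) (j, j') • (lSer l ε (1 : K) i' d * lSer l ε (xi s N) i c) := by
  have hx : xi s N ≠ 0 := xi_ne_zero hs
  have hγ : ((q s)⁻¹ ^ 2 - 1) * (xi s N - 1) * xi s N ≠ 0 :=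
    mul_ne_zero (mul_ne_zero (sub_ne_zero.2 hq) (sub_ne_zero.2 hξ)) hx
  ext m
  have h3 : ∀ (a b : ℤ) (k : ℕ), 3 ≤ k → modeMat l ε (a - k) = 0 ∨ modeMat l ε (b + k) = 0 ∨
      coeffMat A (Rpoly s N) k = 0 := by
    refine fun a b k hk => Or.inr <| Or.inr ?_
    ext x y
    simp [coeffMat, coeff_Rpoly s x y hk]
  -- Summing the coefficients of u^a v^(±m - a) with weight ξ^a is the substitution u = vξ in total
  -- degree ±m.
  have hsum : ∑ᶠ a : ℤ, xi s N ^ a • rllLeft (Rpoly s N) l 1 ε ε a (ε.toInt * m - a) (i, i') (j, j')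
      = ∑ᶠ a : ℤ, xi s N ^ a •
          rllRight (Rpoly s N) l 1 ε ε a (ε.toInt * m - a) (i, i') (j, j') := by
    simp only [h]
  have hab : ∀ (a : ℤ) (k : ℕ), ε.toInt * m - a + k = ε.toInt * m - (a - k) := fun a k => by ring
  have hL : ∀ a : ℤ, rllLeft (Rpoly s N) l 1 ε ε a (ε.toInt * m - a) (i, i') (j, j')
      = ∑ k ∈ Finset.range 3, ∑ p : Fin N × Fin N,
        PowerSeries.coeff k (Rpoly s N (i, i') p)
        • (fun a : ℤ => modeMat l ε a p.1 j * modeMat l ε (ε.toInt * m - a) p.2 j') (a - k) := by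
    intro a
    rw [rllLeft_apply _ _ _ _ _ _ _ 3 (h3 _ _)]
    simp only [Fintype.sum_prod_type, one_pow, one_mul, hab]
  have hR : ∀ a : ℤ, rllRight (Rpoly s N) l 1 ε ε a (ε.toInt * m - a) (i, i') (j, j')
      = ∑ k ∈ Finset.range 3, ∑ p : Fin N × Fin N,
        PowerSeries.coeff k (Rpoly s N p (j, j'))
        • (fun a : ℤ => modeMat l ε (ε.toInt * m - a) i' p.2 * modeMat l ε a i p.1) (a - k) := by
    intro a
    rw [rllRight_apply _ _ _ _ _ _ _ 3 (h3 _ _)]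
    simp only [Fintype.sum_prod_type, one_pow, one_mul, hab]
  simp only [hL, hR] at hsum
  rw [finsum_zpow_smul_shift hx Finset.univ 3 (fun k p => PowerSeries.coeff k (Rpoly s N (i, i') p))
      (fun p a => modeMat l ε a p.1 j * modeMat l ε (ε.toInt * m - a) p.2 j')
      (fun p => support_modeMat_finite l ε _ _ _ _ _),
    finsum_zpow_smul_shift hx Finset.univ 3 (fun k p => PowerSeries.coeff k (Rpoly s N p (j, j')))
      (fun p a => modeMat l ε (ε.toInt * m - a) i' p.2 * modeMat l ε a i p.1)
      (fun p => support_modeMat_finite' l ε _ _ _ _ _)] at hsum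
  simp only [sum_coeff_Rpoly, finsum_modeMat_mul, finsum_modeMat_mul', mul_smul _ (Q _ _ _ _),
    ← Finset.smul_sum] at hsum
  have := smul_right_injective A hγ hsum
  simpa [Fintype.sum_prod_type] using this

/-- The weights `q ^ (-ī)`. -/
noncomputable def weight (s : K) (i : Fin N) : K := s ^ (-bar2 i)

/-- Each entry of Q factors into a row weight and a column weight. The identity for Q therefore
equates a quantity indexed by columns with one indexed by rows, and both are multiples of a single
series. -/
theorem exists_series_of_rll {s : K} (hs : s ≠ 0) (hq : (q s)⁻¹ ^ 2 ≠ 1) (hξ : xi s N ≠ 1)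
    (hN : 0 < N) (l : Sgn → Fin N → Fin N → ℕ → A) (ε : Sgn)
    (h : ∀ a b x y, rllLeft (Rpoly s N) l 1 ε ε a b x y = rllRight (Rpoly s N) l 1 ε ε a b x y) :
    ∃ z : A⟦X⟧,
      (∀ a b, ∑ j : Fin N, weight s j • (lSer l ε (xi s N) j.rev a * lSer l ε (1 : K) j b)
        = if a = b.rev then weight s b • z else 0) ∧
      (∀ a b, ∑ j : Fin N, weight s j.rev • (lSer l ε (1 : K) b j * lSer l ε (xi s N) a j.rev)
        = if a = b.rev then weight s b.rev • z else 0) := by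
  let i₀ : Fin N := ⟨0, hN⟩
  have key := sum_Q_mul_lSer hs hq hξ l ε h
  have hw : ∀ i : Fin N, weight s i ≠ 0 := fun i => zpow_ne_zero _ hs
  have hqw : ∀ i j : Fin N, qbar s i j = weight s j * weight s i.rev := by
    intro i j
    rw [qbar, weight, weight, bar2_rev, ← zpow_add₀ hs]
    congr 1
    ring
  have hwr : ∀ i : Fin N, weight s i.rev * weight s i = 1 := by
    intro i
    rw [weight, weight, bar2_rev, ← zpow_add₀ hs, neg_neg, add_neg_cancel, zpow_zero]
  set S : Fin N → Fin N → A⟦X⟧ := fun a b =>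
    ∑ j : Fin N, weight s j • (lSer l ε (xi s N) j.rev a * lSer l ε (1 : K) j b) with hS
  set T : Fin N → Fin N → A⟦X⟧ := fun a b =>
    ∑ j : Fin N, weight s j.rev • (lSer l ε (1 : K) b j * lSer l ε (xi s N) a j.rev) with hT
  have hL : ∀ i i' j j' : Fin N,
      ∑ c, ∑ d, Q s N (i, i') (c, d) • (lSer l ε (xi s N) c j * lSer l ε (1 : K) d j')
        = if i' = i.rev then weight s i • S j j' else 0 := by
    intro i i' j j'
    by_cases hi : i' = i.rev
    · subst hi
      rw [if_pos rfl, hS, Finset.smul_sum, ← Equiv.sum_comp Fin.revPerm]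
      refine Finset.sum_congr rfl fun c _ => ?_
      rw [Finset.sum_eq_single c]
      · rw [Q_apply, if_pos ⟨rfl, by simp⟩, hqw, smul_smul]
        simp
      · intro d _ hd
        rw [Q_apply, if_neg (by simpa using hd), zero_smul]
      · simp
    · rw [if_neg hi]
      refine Finset.sum_eq_zero fun c _ => Finset.sum_eq_zero fun d _ => ?_
      rw [Q_apply, if_neg (by tauto), zero_smul]
  have hR : ∀ i i' j j' : Fin N,
      ∑ c, ∑ d, Q s N (c, d) (j, j') • (lSer l ε (1 : K) i' d * lSer l ε (xi s N) i c)
        = if j' = j.rev then weight s j.rev • T i i' else 0 := by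
    intro i i' j j'
    by_cases hj : j' = j.rev
    · subst hj
      rw [if_pos rfl, hT, Finset.smul_sum, ← Equiv.sum_comp Fin.revPerm]
      refine Finset.sum_congr rfl fun c _ => ?_
      rw [Finset.sum_eq_single c]
      · rw [Q_apply, if_pos ⟨by simp, rfl⟩, hqw, smul_smul]
        simp [mul_comm]
      · intro d _ hd
        rw [Q_apply, if_neg (by simpa using hd), zero_smul]
      · simp
    · rw [if_neg hj]
      refine Finset.sum_eq_zero fun c _ => Finset.sum_eq_zero fun d _ => ?_
      rw [Q_apply, if_neg (by tauto), zero_smul]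
  have hrel : ∀ i i' j j' : Fin N, (if i' = i.rev then weight s i • S j j' else 0)
      = if j' = j.rev then weight s j.rev • T i i' else 0 := fun i i' j j' => by
    rw [← hL, ← hR, key]
  have hr : ∀ a b : Fin N, b = a.rev ↔ a = b.rev := fun a b => by rw [eq_comm, Fin.rev_eq_iff]
  -- Any index could serve as the reference `i₀`; the factor `weight s i₀.rev` cancels the row
  -- weight of `i₀`.
  refine ⟨weight s i₀.rev • T i₀ i₀.rev, fun a b => ?_, fun a b => ?_⟩
  · have h1 := congrArg (weight s i₀.rev • ·) (hrel i₀ i₀.rev a b)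
    simp only [if_true, smul_smul, hwr, one_smul, smul_ite, smul_zero, hr a b] at h1
    change S a b = _
    rw [h1]
    refine ite_congr rfl (fun hab => ?_) fun _ => rfl
    rw [hab, Fin.rev_rev, smul_smul, mul_comm]
  · have h1 := congrArg (weight s i₀.rev • ·) (hrel i₀ i₀.rev i₀ i₀.rev)
    simp only [if_true, smul_smul, hwr, one_smul] at h1
    have h2 := congrArg (weight s i₀ • ·) (hrel a b i₀ i₀.rev)
    simp only [if_true, smul_smul, mul_comm (weight s i₀), hwr, one_smul, smul_ite, smul_zero,
      hr a b] at h2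
    change T a b = _
    rw [← h2]
    refine ite_congr rfl (fun hab => ?_) fun _ => rfl
    rw [hab, h1, smul_smul, smul_smul]
    congr 1
    linear_combination (weight s b.rev * weight s i₀.rev) * hwr i₀

end Specialization

/-! ### Crossing symmetry in coordinates, for either tensor factor. -/

section Crossing

variable {K : Type*} [Field K] {N : ℕ}

theorem crossing_Rser_apply {s : K} (hs : s ≠ 0) (hN : 2 ≤ N)
    (h : ∀ k : ℕ, 0 < k → 1 + xi s N ^ k ≠ 0) (a b k l : Fin N) :
    ∑ j, weight s j • ∑ m, PowerSeries.rescale (xi s N) (Rser s N (j.rev, k) (a, m))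
        * Rser s N (j, m) (b, l)
      = if a = b.rev ∧ k = l then (xi s N ^ 2 * (q s)⁻¹ ^ 2 * weight s b) • (1 : K⟦X⟧) else 0 := by
  have h1 := congrFun (congrFun (crossing_Rser hs hN h) (a.rev, k)) (b, l)
  rw [Matrix.mul_apply, Fintype.sum_prod_type, Matrix.smul_apply, Matrix.one_apply] at h1
  have h2 := congrArg (weight s a.rev • ·) h1
  have h3 : ∀ j : Fin N, weight s a.rev * qbar s a.rev j = weight s j := by
    intro j
    rw [weight, weight, qbar, ← zpow_add₀ hs]
    congr 1
    ring
  have h4 : (a.rev, k) = (b, l) ↔ a = b.rev ∧ k = l := by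
    rw [Prod.mk.injEq, Fin.rev_eq_iff]
  simp only [star, Matrix.of_apply, Matrix.map_apply, Fin.rev_rev, smul_mul_assoc, h4,
    Finset.smul_sum, smul_smul, h3] at h2
  simp only [Finset.smul_sum]
  rw [h2]
  split_ifs with hab
  · rw [hab.1, Fin.rev_rev, smul_eq_mul, mul_one, ← mul_one (PowerSeries.C _),
      ← PowerSeries.smul_eq_C_mul, smul_smul, mul_comm]
  · simp

theorem Rser_symm (s : K) (a b c d : Fin N) :
    Rser s N (c, d) (a, b) = Rser s N (b, a) (d, c) := by
  have h1 : R s N (c, d) (a, b) = R s N (b, a) (d, c) := by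
    have := congrFun (congrFun (R_transpose (N := N) s) (a, b)) (c, d)
    rwa [mul_P_apply, P_mul_apply, Matrix.transpose_apply] at this
  have h2 : Q s N (c, d) (a, b) = Q s N (b, a) (d, c) := by
    have := congrFun (congrFun (Q_transpose (N := N) s) (a, b)) (c, d)
    rwa [mul_P_apply, P_mul_apply, Matrix.transpose_apply] at this
  have h3 : P K N (c, d) (a, b) = P K N (b, a) (d, c) := by
    rw [P_apply, P_apply]
    congr 1
    simp only [eq_iff_iff]
    constructor <;> rintro ⟨rfl, rfl⟩ <;> simp
  simp only [Rser, Matrix.smul_apply, Matrix.add_apply, Matrix.sub_apply, const, Matrix.map_apply,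
    h1, h2, h3]

/-- Crossing in the second tensor factor follows from the first: `Rser_symm` interchanges the
factors and reverses products, and the entries commute. -/
theorem crossing_Rser_apply' {s : K} (hs : s ≠ 0) (hN : 2 ≤ N)
    (h : ∀ k : ℕ, 0 < k → 1 + xi s N ^ k ≠ 0) (a b k l : Fin N) :
    ∑ j, weight s j.rev • ∑ m, Rser s N (k, a) (m, j.rev)
        * PowerSeries.rescale (xi s N) (Rser s N (m, b) (l, j))
      = if a = b.rev ∧ k = l then (xi s N ^ 2 * (q s)⁻¹ ^ 2 * weight s b.rev) • (1 : K⟦X⟧)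
        else 0 := by
  have h1 := crossing_Rser_apply hs hN h b a l k
  rw [← Equiv.sum_comp Fin.revPerm] at h1
  simp only [Fin.revPerm_apply, Fin.rev_rev] at h1
  have h2 : ∀ m j : Fin N, Rser s N (k, a) (m, j.rev)
        * PowerSeries.rescale (xi s N) (Rser s N (m, b) (l, j))
      = PowerSeries.rescale (xi s N) (Rser s N (j, l) (b, m)) * Rser s N (j.rev, m) (a, k) := by
    intro m j
    rw [mul_comm, Rser_symm s l j m b, Rser_symm s m j.rev k a]
  simp only [h2, h1]
  have h3 : b = a.rev ∧ l = k ↔ a = b.rev ∧ k = l := by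
    rw [eq_comm (a := l), eq_comm (a := b), Fin.rev_eq_iff]
  simp only [h3]
  refine ite_congr rfl (fun hab => ?_) fun _ => rfl
  rw [hab.1]

end Crossing

/-! ### The coefficients of z commute with the generators. -/

section Centrality

variable {K A : Type*} [Field K] [Ring A] [Algebra K A] {N : ℕ}

/-- A series in `u` as a scalar matrix over the series in `u` and `v`. -/
noncomputable def scalarSer (N : ℕ) : A⟦X⟧ →+* Matrix (Fin N) (Fin N) (HahnSeries ℤ A)⟦X⟧ :=
  (Matrix.scalar (Fin N)).comp (PowerSeries.map (HahnSeries.C : A →+* HahnSeries ℤ A))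

theorem mul_scalarSer_apply (M : Matrix (Fin N) (Fin N) (HahnSeries ℤ A)⟦X⟧) (y : A⟦X⟧)
    (i j : Fin N) :
    (M * scalarSer N y) i j = M i j * PowerSeries.map (HahnSeries.C : A →+* HahnSeries ℤ A) y := by
  simp [scalarSer, Matrix.scalar_apply, Matrix.mul_diagonal]

theorem scalarSer_mul_apply (M : Matrix (Fin N) (Fin N) (HahnSeries ℤ A)⟦X⟧) (y : A⟦X⟧)
    (i j : Fin N) :
    (scalarSer N y * M) i j = PowerSeries.map (HahnSeries.C : A →+* HahnSeries ℤ A) y * M i j := by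
  simp [scalarSer, Matrix.scalar_apply, Matrix.diagonal_mul]

theorem scalarSer_smul (c : K) (y : A⟦X⟧) : scalarSer N (c • y) = c • scalarSer N y := by
  have h : PowerSeries.map (HahnSeries.C : A →+* HahnSeries ℤ A) (c • y)
      = c • PowerSeries.map (HahnSeries.C : A →+* HahnSeries ℤ A) y := by
    refine PowerSeries.ext fun m => ?_
    simp only [PowerSeries.coeff_map]
    refine HahnSeries.ext (funext fun n => ?_)
    simp [HahnSeries.C_apply, HahnSeries.coeff_single]
  ext i j : 1
  simp only [scalarSer, RingHom.comp_apply, h, Matrix.scalar_apply, Matrix.diagonal_apply,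
    Matrix.smul_apply, smul_ite, smul_zero]

theorem smul_single_eq (c : K) (n : ℤ) (w : A) :
    c • HahnSeries.single n w = HahnSeries.single n (c • w) := by
  refine HahnSeries.ext (funext fun m => ?_)
  simp [HahnSeries.coeff_single]

theorem commute_of_commute_scalarSer {l : Sgn → Fin N → Fin N → ℕ → A} {δ : Sgn} {z : A⟦X⟧}
    (h : Commute (scalarSer N z) (Matrix.of fun i j => innerSer l δ i j)) (m : ℕ) (i j : Fin N)
    (n : ℕ) : Commute (PowerSeries.coeff m z) (l δ i j n) := by
  have h1 := congrFun (congrFun h.eq i) j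
  rw [mul_scalarSer_apply, scalarSer_mul_apply, Matrix.of_apply, innerSer] at h1
  have h2 := congrArg (fun y => (PowerSeries.coeff m y).coeff (n : ℤ)) h1
  simp only [PowerSeries.coeff_mul_C, PowerSeries.coeff_C_mul, PowerSeries.coeff_map,
    HahnSeries.C_apply] at h2
  rw [← add_zero (n : ℤ), HahnSeries.coeff_single_mul_add,
    HahnSeries.coeff_mul_single_add, ofPowerSeries_coeff_eq_modeMat, modeMat_toInt_mul] at h2
  exact h2

/-- The matrix `R(t u)` with the first tensor factor as outer index. -/
noncomputable def outerFst (Rm : Matrix (Fin N × Fin N) (Fin N × Fin N) K⟦X⟧)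
    (t : HahnSeries ℤ A) (i j : Fin N) : Matrix (Fin N) (Fin N) (HahnSeries ℤ A)⟦X⟧ :=
  Matrix.of fun k m => ev t (Rm (i, k) (j, m))

/-- The matrix `R(t u)` with the second tensor factor as outer index. -/
noncomputable def outerSnd (Rm : Matrix (Fin N × Fin N) (Fin N × Fin N) K⟦X⟧)
    (t : HahnSeries ℤ A) (i j : Fin N) : Matrix (Fin N) (Fin N) (HahnSeries ℤ A)⟦X⟧ :=
  Matrix.of fun k m => ev t (Rm (k, i) (m, j))

theorem commute_of_scalarSer {t : HahnSeries ℤ A} (ht : ∀ x, Commute t x)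
    (M : Matrix (Fin N) (Fin N) K⟦X⟧) (y : A⟦X⟧) :
    Commute (Matrix.of fun k m => ev t (M k m)) (scalarSer N y) := by
  refine Matrix.ext fun i j => ?_
  rw [mul_scalarSer_apply, scalarSer_mul_apply, Matrix.of_apply, (commute_ev ht _ _).eq]

/-- Fusion in the ring of matrices in the second tensor factor: the entries of L(u) are scalar
matrices there, and x is the whole matrix L(v). -/
theorem commute_coeff_of_plus {s : K} (hs : s ≠ 0) (hN : 2 ≤ N)
    (hξ : ∀ k : ℕ, 0 < k → 1 + xi s N ^ k ≠ 0) (l : Sgn → Fin N → Fin N → ℕ → A) {z : A⟦X⟧}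
    (hz : ∀ a b, ∑ j : Fin N, weight s j • (lSer l .plus (xi s N) j.rev a * lSer l .plus (1 : K) j b)
        = if a = b.rev then weight s b • z else 0)
    {w w' : A} (hw : ∀ x, Commute w x) (hw' : ∀ x, Commute w' x) {δ : Sgn}
    (h : ∀ a b x y, rllLeft (Rser s N) l w .plus δ a b x y = rllRight (Rser s N) l w' .plus δ a b x y)
    (m : ℕ) (i j : Fin N) (n : ℕ) : Commute (PowerSeries.coeff m z) (l δ i j n) := by
  have ht : ∀ (c : K) (w : A), (∀ x, Commute w x) →
      ∀ x, Commute (HahnSeries.single (-δ.toInt) (c • w)) x := fun c w hw x =>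
    commute_single (fun y => (hw y).smul_left c) _ x
  have hRL : ∀ (c : K) (i j : Fin N),
      ∑ d, outerFst (Rser s N) (HahnSeries.single (-δ.toInt) (c • w)) i d
          * scalarSer N (lSer l .plus c d j) * (Matrix.of fun i j => innerSer l δ i j)
        = ∑ d, (Matrix.of fun i j => innerSer l δ i j) * scalarSer N (lSer l .plus c i d)
          * outerFst (Rser s N) (HahnSeries.single (-δ.toInt) (c • w')) d j := by
    intro c i j
    refine Matrix.ext fun k k' => ?_
    simp only [Matrix.sum_apply, Matrix.mul_apply (N := Matrix.of _),
      Matrix.mul_apply (N := outerFst _ _ _ _), mul_scalarSer_apply]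
    exact sum_ev_mul_left_eq (Rser s N) l hw' h c i k j k'
  have hR : ∀ (w : A) (a b : Fin N), ∑ j : Fin N, weight s j •
      (outerFst (Rser s N) (HahnSeries.single (-δ.toInt) (xi s N • w)) j.rev a
        * outerFst (Rser s N) (HahnSeries.single (-δ.toInt) ((1 : K) • w)) j b)
      = if a = b.rev then (xi s N ^ 2 * (q s)⁻¹ ^ 2 * weight s b) • 1 else 0 := by
    intro w a b
    refine Matrix.ext fun k k' => ?_
    have h1 := congrArg (ev (HahnSeries.single (-δ.toInt) w))
      (crossing_Rser_apply hs hN hξ a b k k')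
    simp only [map_sum, ev_smul, map_mul, ev_rescale, smul_single_eq] at h1
    simp only [Matrix.sum_apply, Matrix.smul_apply, Matrix.mul_apply, outerFst, Matrix.of_apply,
      one_smul, h1]
    by_cases hab : a = b.rev <;> by_cases hk : k = k' <;>
      simp [hab, hk, ev_smul]
  refine commute_of_commute_scalarSer (commute_of_fusion_left Fin.rev (weight s)
    (xi s N ^ 2 * (q s)⁻¹ ^ 2) (hRL 1) (hRL (xi s N)) ?_ ?_ ?_ (hR w) (hR w') i ?_ ?_) m i j n
  · exact fun i j k l => commute_of_scalarSer (ht _ _ hw) _ _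
  · exact fun i j k l => commute_of_scalarSer (ht _ _ hw') _ _
  · intro a b
    have h1 := congrArg (scalarSer N) (hz a b)
    simpa only [map_sum, scalarSer_smul, map_mul, apply_ite (scalarSer N), map_zero] using h1
  · exact mul_ne_zero (pow_ne_zero _ (xi_ne_zero hs))
      (pow_ne_zero _ (inv_ne_zero (q_ne_zero hs)))
  · exact zpow_ne_zero _ hs

theorem commute_coeff_of_minus {s : K} (hs : s ≠ 0) (hN : 2 ≤ N)
    (hξ : ∀ k : ℕ, 0 < k → 1 + xi s N ^ k ≠ 0) (l : Sgn → Fin N → Fin N → ℕ → A) {z : A⟦X⟧}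
    (hz : ∀ a b, ∑ j : Fin N, weight s j.rev •
        (lSer l .minus (1 : K) b j * lSer l .minus (xi s N) a j.rev)
        = if a = b.rev then weight s b.rev • z else 0)
    {w w' : A} (hw : ∀ x, Commute w x) (hw' : ∀ x, Commute w' x) {δ : Sgn}
    (h : ∀ a b x y,
      rllLeft (Rser s N) l w δ .minus a b x y = rllRight (Rser s N) l w' δ .minus a b x y)
    (m : ℕ) (i j : Fin N) (n : ℕ) : Commute (PowerSeries.coeff m z) (l δ i j n) := by
  have ht : ∀ (c : K) (w : A), (∀ x, Commute w x) →
      ∀ x, Commute (HahnSeries.single δ.toInt (c • w)) x := fun c w hw x =>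
    commute_single (fun y => (hw y).smul_left c) _ x
  have hRL : ∀ (c : K) (i j : Fin N),
      ∑ d, outerSnd (Rser s N) (HahnSeries.single δ.toInt (c⁻¹ • w)) i d
          * (Matrix.of fun i j => innerSer l δ i j) * scalarSer N (lSer l .minus c d j)
        = ∑ d, scalarSer N (lSer l .minus c i d) * (Matrix.of fun i j => innerSer l δ i j)
          * outerSnd (Rser s N) (HahnSeries.single δ.toInt (c⁻¹ • w')) d j := by
    intro c i j
    refine Matrix.ext fun k k' => ?_
    simp only [Matrix.sum_apply, mul_scalarSer_apply, Matrix.mul_apply (N := outerSnd _ _ _ _),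
      scalarSer_mul_apply]
    simp only [Matrix.mul_apply (N := Matrix.of _), Finset.sum_mul]
    exact sum_ev_mul_right_eq (Rser s N) l hw' h c⁻¹ i k j k'
  have hR : ∀ (w : A) (a b : Fin N), ∑ j : Fin N, weight s j.rev •
      (outerSnd (Rser s N) (HahnSeries.single δ.toInt ((xi s N)⁻¹ • w)) a j.rev
        * outerSnd (Rser s N) (HahnSeries.single δ.toInt ((1 : K)⁻¹ • w)) b j)
      = if a = b.rev then (xi s N ^ 2 * (q s)⁻¹ ^ 2 * weight s b.rev) • 1 else 0 := by
    intro w a b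
    refine Matrix.ext fun k k' => ?_
    -- Replacing u by uξ multiplies v/u by ξ^{-1}. Crossing is therefore evaluated at the argument
    -- divided by ξ, and its rescaled factor becomes the unshifted one.
    have h1 := congrArg (ev (HahnSeries.single δ.toInt ((xi s N)⁻¹ • w)))
      (crossing_Rser_apply' hs hN hξ a b k k')
    simp only [map_sum, ev_smul, map_mul, ev_rescale, smul_single_eq, smul_smul,
      mul_inv_cancel₀ (xi_ne_zero (N := N) hs)] at h1
    simp only [Matrix.sum_apply, Matrix.smul_apply, Matrix.mul_apply, outerSnd, Matrix.of_apply,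
      inv_one, h1]
    by_cases hab : a = b.rev <;> by_cases hk : k = k' <;>
      simp [hab, hk, ev_smul]
  refine commute_of_commute_scalarSer (commute_of_fusion_right Fin.rev (fun j => weight s j.rev)
    (xi s N ^ 2 * (q s)⁻¹ ^ 2) (hRL (xi s N)) (hRL 1) ?_ ?_ ?_ (hR w) (hR w') i ?_ ?_) m i j n
  · exact fun i j k l => commute_of_scalarSer (ht _ _ hw) _ _
  · exact fun i j k l => commute_of_scalarSer (ht _ _ hw') _ _
  · intro a b
    have h1 := congrArg (scalarSer N) (hz a b)
    simpa only [map_sum, scalarSer_smul, map_mul, apply_ite (scalarSer N), map_zero] using h1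
  · exact mul_ne_zero (pow_ne_zero _ (xi_ne_zero hs))
      (pow_ne_zero _ (inv_ne_zero (q_ne_zero hs)))
  · exact zpow_ne_zero _ hs

end Centrality

/-! ### The relations inside the quotient algebra. -/

section Presentation

variable {K : Type*} [Field K] {N : ℕ}

section Map

variable {A B : Type*} [Ring A] [Algebra K A] [Ring B] [Algebra K B]
  (Rm : Matrix (Fin N × Fin N) (Fin N × Fin N) K⟦X⟧)

theorem map_modeMat_apply (φ : A →ₐ[K] B) (l : Sgn → Fin N → Fin N → ℕ → A) (ε : Sgn) (m : ℤ)
    (i j : Fin N) :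
    φ (modeMat l ε m i j) = modeMat (fun ε i j m => φ (l ε i j m)) ε m i j := by
  rw [modeMat_apply, modeMat_apply, apply_ite φ, map_zero]

/-- The sign condition makes the defining sum finite, and this is what lets a homomorphism pass
through it. -/
theorem map_rllLeft (φ : A →ₐ[K] B) (l : Sgn → Fin N → Fin N → ℕ → A) (w : A) {ε₁ ε₂ : Sgn}
    (hε : ¬ (ε₁ = .minus ∧ ε₂ = .plus)) (a b : ℤ) (x y : Fin N × Fin N) :
    φ (rllLeft Rm l w ε₁ ε₂ a b x y)
      = rllLeft Rm (fun ε i j m => φ (l ε i j m)) (φ w) ε₁ ε₂ a b x y := by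
  obtain ⟨i, i'⟩ := x
  obtain ⟨j, j'⟩ := y
  rw [rllLeft_apply Rm l w _ _ _ _ (a.natAbs + b.natAbs + 1)
      fun k hk => (modeMat_eq_zero l _ _ hε a b k hk).imp_right Or.inl,
    rllLeft_apply Rm _ _ _ _ _ _ (a.natAbs + b.natAbs + 1)
      fun k hk => (modeMat_eq_zero _ _ _ hε a b k hk).imp_right Or.inl]
  simp only [map_sum, map_smul, map_mul, map_pow, map_modeMat_apply]

theorem map_rllRight (φ : A →ₐ[K] B) (l : Sgn → Fin N → Fin N → ℕ → A) (w : A) {ε₁ ε₂ : Sgn}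
    (hε : ¬ (ε₁ = .minus ∧ ε₂ = .plus)) (a b : ℤ) (x y : Fin N × Fin N) :
    φ (rllRight Rm l w ε₁ ε₂ a b x y)
      = rllRight Rm (fun ε i j m => φ (l ε i j m)) (φ w) ε₁ ε₂ a b x y := by
  obtain ⟨i, i'⟩ := x
  obtain ⟨j, j'⟩ := y
  rw [rllRight_apply Rm l w _ _ _ _ (a.natAbs + b.natAbs + 1)
      fun k hk => (modeMat_eq_zero l _ _ hε a b k hk).imp_right Or.inl,
    rllRight_apply Rm _ _ _ _ _ _ (a.natAbs + b.natAbs + 1)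
      fun k hk => (modeMat_eq_zero _ _ _ hε a b k hk).imp_right Or.inl]
  simp only [map_sum, map_smul, map_mul, map_pow, map_modeMat_apply]

end Map

variable (Rm : Matrix (Fin N × Fin N) (Fin N × Fin N) K⟦X⟧)

/-- The image of `q^{c/2}` in the algebra. -/
noncomputable def qc : RAlg Rm := RingQuot.mkAlgHom K (Rel Rm) (FreeAlgebra.ι K Gen.qc)

/-- The image of `q^{-c/2}` in the algebra. -/
noncomputable def qcInv : RAlg Rm := RingQuot.mkAlgHom K (Rel Rm) (FreeAlgebra.ι K Gen.qcInv)

theorem rll_gen (ε : Sgn) (a b : ℤ) (x y : Fin N × Fin N) :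
    rllLeft Rm (gen Rm) 1 ε ε a b x y = rllRight Rm (gen Rm) 1 ε ε a b x y := by
  have h := RingQuot.mkAlgHom_rel K (Rel.rll (Rm := Rm) ε a b x y)
  have hε : ¬ (ε = .minus ∧ ε = .plus) := by rintro ⟨rfl, h⟩; cases h
  rwa [map_rllLeft _ _ _ _ hε, map_rllRight _ _ _ _ hε, map_one] at h

theorem rll_mixed_gen (a b : ℤ) (x y : Fin N × Fin N) :
    rllLeft Rm (gen Rm) (qc Rm ^ 2) .plus .minus a b x y
      = rllRight Rm (gen Rm) (qcInv Rm ^ 2) .plus .minus a b x y := by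
  have h := RingQuot.mkAlgHom_rel K (Rel.rll_mixed (Rm := Rm) a b x y)
  have hε : ¬ (Sgn.plus = .minus ∧ Sgn.minus = .plus) := by rintro ⟨h, -⟩; cases h
  rwa [map_rllLeft _ _ _ _ hε, map_rllRight _ _ _ _ hε, map_pow, map_pow] at h

theorem qc_mul_qcInv : qc Rm * qcInv Rm = 1 := by
  rw [qc, qcInv, ← map_mul, RingQuot.mkAlgHom_rel K Rel.qc_mul_inv, map_one]

theorem qcInv_mul_qc : qcInv Rm * qc Rm = 1 := by
  rw [qc, qcInv, ← map_mul, RingQuot.mkAlgHom_rel K Rel.inv_mul_qc, map_one]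

theorem commute_qc_gen (ε : Sgn) (i j : Fin N) (m : ℕ) : Commute (qc Rm) (gen Rm ε i j m) := by
  rw [Commute, SemiconjBy, qc, gen, ← map_mul, ← map_mul,
    RingQuot.mkAlgHom_rel K (Rel.qc_comm ε i j m)]

variable {Rm}

theorem commute_of_generators {x : RAlg Rm} (h1 : Commute x (qc Rm)) (h2 : Commute x (qcInv Rm))
    (h3 : ∀ ε i j m, Commute x (gen Rm ε i j m)) (y : RAlg Rm) : Commute x y := by
  obtain ⟨y, rfl⟩ := RingQuot.mkAlgHom_surjective K (Rel Rm) y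
  induction y with
  | grade0 r => rw [AlgHom.commutes]; exact (Algebra.commutes r x).symm
  | grade1 g =>
    cases g with
    | qc => exact h1
    | qcInv => exact h2
    | l ε i j m => exact h3 ε i j m
  | mul a b ha hb => rw [map_mul]; exact ha.mul_right hb
  | add a b ha hb => rw [map_add]; exact ha.add_right hb

theorem commute_qcInv_of_commute_qc {x : RAlg Rm} (h : Commute x (qc Rm)) :
    Commute x (qcInv Rm) := by
  let u : (RAlg Rm)ˣ := ⟨qc Rm, qcInv Rm, qc_mul_qcInv Rm, qcInv_mul_qc Rm⟩
  exact Commute.units_inv_right (u := u) h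

variable (Rm)

theorem commute_qc (x : RAlg Rm) : Commute (qc Rm) x :=
  commute_of_generators (Commute.refl _) (commute_qcInv_of_commute_qc (Commute.refl _))
    (commute_qc_gen Rm) x

theorem commute_qcInv (x : RAlg Rm) : Commute (qcInv Rm) x :=
  (commute_qcInv_of_commute_qc (commute_qc Rm x).symm).symm

end Presentation

/-! ### The scalar factors relating both R-matrices to `Rpoly`. -/

section Units

variable {K : Type*} [Field K] {N : ℕ}

/-- The factor is q / ((uq - q^{-1})(u - ξ)), a unit because both linear forms have nonzero constant
term. -/
theorem Rbarser_eq {s : K} (hs : s ≠ 0) :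
    ∃ g g' : K⟦X⟧, g' * g = 1 ∧ Rbarser s N = g • Rpoly s N := by
  have hq : q s ≠ 0 := q_ne_zero hs
  have h1 : (PowerSeries.X * PowerSeries.C (q s) - PowerSeries.C (q s)⁻¹ : K⟦X⟧)
      * (PowerSeries.X * PowerSeries.C (q s) - PowerSeries.C (q s)⁻¹)⁻¹ = 1 :=
    PowerSeries.mul_inv_cancel _ (by simpa using hq)
  have h2 : (PowerSeries.X - PowerSeries.C (xi s N) : K⟦X⟧)
      * (PowerSeries.X - PowerSeries.C (xi s N))⁻¹ = 1 :=
    PowerSeries.mul_inv_cancel _ (by simpa using xi_ne_zero hs)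
  have h3 : (PowerSeries.C (q s)⁻¹ : K⟦X⟧) * PowerSeries.C (q s) = 1 := by
    rw [← map_mul, inv_mul_cancel₀ hq, map_one]
  refine ⟨PowerSeries.C (q s) * (PowerSeries.X * PowerSeries.C (q s) - PowerSeries.C (q s)⁻¹)⁻¹
      * (PowerSeries.X - PowerSeries.C (xi s N))⁻¹,
    PowerSeries.C (q s)⁻¹ * (PowerSeries.X * PowerSeries.C (q s) - PowerSeries.C (q s)⁻¹)
      * (PowerSeries.X - PowerSeries.C (xi s N)), ?_, ?_⟩
  · generalize (PowerSeries.X * PowerSeries.C (q s) - PowerSeries.C (q s)⁻¹ : K⟦X⟧)⁻¹ = a at *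
    generalize (PowerSeries.X - PowerSeries.C (xi s N) : K⟦X⟧)⁻¹ = b at *
    generalize (PowerSeries.X * PowerSeries.C (q s) - PowerSeries.C (q s)⁻¹ : K⟦X⟧) = a' at *
    generalize (PowerSeries.X - PowerSeries.C (xi s N) : K⟦X⟧) = b' at *
    linear_combination h3 + PowerSeries.C (q s)⁻¹ * PowerSeries.C (q s) * h1
      + PowerSeries.C (q s)⁻¹ * PowerSeries.C (q s) * (a' * a) * h2
  · refine Matrix.ext fun x y => ?_
    simp only [Rbarser, Rpoly, Matrix.add_apply, Matrix.sub_apply, Matrix.smul_apply, smul_eq_mul,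
      map_sub, map_pow, map_one]
    generalize (PowerSeries.X * PowerSeries.C (q s) - PowerSeries.C (q s)⁻¹ : K⟦X⟧)⁻¹ = a at *
    generalize (PowerSeries.X - PowerSeries.C (xi s N) : K⟦X⟧)⁻¹ = b at *
    generalize (PowerSeries.X - PowerSeries.C (xi s N) : K⟦X⟧) = b' at *
    generalize (PowerSeries.C (q s) : K⟦X⟧) = c at *
    generalize (PowerSeries.C (q s)⁻¹ : K⟦X⟧) = c' at *
    linear_combination
      -(PowerSeries.X - 1) * a * (h3 + c * c' * h2) * const (R s N) x y
      + a * (c' * h3 + c * (c' ^ 2 - 1) * h2) * const (P K N) x y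
      - (PowerSeries.X - 1) * PowerSeries.C (xi s N) * a * b * c' * h3 * const (Q s N) x y

theorem inv_f_mul_f (s : K) : (f s N)⁻¹ * f s N = 1 :=
  PowerSeries.inv_mul_cancel _ (by simp [constantCoeff_f])

end Units

/-! ### Genericity of q. -/

section Transcendental

variable {K : Type*} [Field K] [Algebra ℂ K] {s : K}

/-- The single source of all nondegeneracy: s ≠ 0, q^{-2} ≠ 1, ξ ≠ 1, and ξ^k ≠ -1 for k > 0, the
last making the recursion for f solvable. -/
theorem zpow_ne_of_transcendental (hs : Transcendental ℂ s) {n : ℤ} (hn : n ≠ 0) (c : ℂ) :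
    s ^ n ≠ algebraMap ℂ K c := by
  have hpow : ∀ {m : ℕ} (c : ℂ), 0 < m → s ^ m ≠ algebraMap ℂ K c := fun c hm h =>
    hs.pow hm (h ▸ isAlgebraic_algebraMap c)
  intro h
  rcases lt_or_gt_of_ne hn with hn | hn
  · obtain ⟨m, rfl⟩ := Int.exists_eq_neg_ofNat hn.le
    rw [zpow_neg, zpow_natCast, inv_eq_iff_eq_inv, ← map_inv₀] at h
    exact hpow _ (by omega) h
  · obtain ⟨m, rfl⟩ := Int.eq_ofNat_of_zero_le hn.le
    rw [zpow_natCast] at h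
    exact hpow _ (by omega) h

end Transcendental

/-! ### Matrix form of the identities and the final assembly. -/

section Main

variable {K A : Type*} [Field K] [Ring A] [Algebra K A] {N : ℕ}

theorem inv_D (s : K) (hs : s ≠ 0) :
    (D s N)⁻¹ = Matrix.diagonal fun i => s ^ (-bar2 i) := by
  refine Matrix.inv_eq_right_inv ?_
  rw [D, Matrix.diagonal_mul_diagonal, ← Matrix.diagonal_one]
  congr 1
  funext i
  rw [← zpow_add₀ hs, add_neg_cancel, zpow_zero]

theorem lift_diagonal (d : Fin N → K) :
    lift A (Matrix.diagonal d) = Matrix.diagonal fun i => algebraMap K A⟦X⟧ (d i) :=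
  Matrix.diagonal_map (map_zero _)

theorem exists_scalar_of_rll {s : K} (hs : s ≠ 0) (hq : (q s)⁻¹ ^ 2 ≠ 1) (hξ : xi s N ≠ 1)
    (hN : 0 < N) (l : Sgn → Fin N → Fin N → ℕ → A) (ε : Sgn)
    (h : ∀ a b x y, rllLeft (Rpoly s N) l 1 ε ε a b x y = rllRight (Rpoly s N) l 1 ε ε a b x y) :
    ∃ z : A⟦X⟧,
      (∀ a b, ∑ j : Fin N, weight s j • (lSer l ε (xi s N) j.rev a * lSer l ε (1 : K) j b)
        = if a = b.rev then weight s b • z else 0) ∧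
      (∀ a b, ∑ j : Fin N, weight s j.rev • (lSer l ε (1 : K) b j * lSer l ε (xi s N) a j.rev)
        = if a = b.rev then weight s b.rev • z else 0) ∧
      lift A (D s N) * tr (Matrix.of (lSer l ε (xi s N))) * lift A (D s N)⁻¹
          * Matrix.of (lSer l ε (1 : K)) = z • (1 : Matrix (Fin N) (Fin N) A⟦X⟧) ∧
      Matrix.of (lSer l ε (1 : K)) * lift A (D s N) * tr (Matrix.of (lSer l ε (xi s N)))
          * lift A (D s N)⁻¹ = z • (1 : Matrix (Fin N) (Fin N) A⟦X⟧) := by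
  obtain ⟨z, h1, h2⟩ := exists_series_of_rll hs hq hξ hN l ε h
  have hw : ∀ i : Fin N, weight s i.rev = s ^ bar2 i := fun i => by
    rw [weight, bar2_rev, neg_neg]
  have hwm : ∀ i : Fin N, weight s i.rev * weight s i = 1 := fun i => by
    rw [hw, weight, ← zpow_add₀ hs, add_neg_cancel, zpow_zero]
  refine ⟨z, h1, h2, ?_, ?_⟩ <;> refine Matrix.ext fun a b => ?_ <;>
    rw [inv_D s hs, D, lift_diagonal, lift_diagonal]
  · have h3 := congrArg (weight s a.rev • ·) (h1 a.rev b)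
    simp only [Finset.smul_sum, smul_ite, smul_zero] at h3
    rw [Matrix.mul_apply, Matrix.smul_apply, Matrix.one_apply]
    refine (Finset.sum_congr rfl fun j _ => ?_).trans (h3.trans ?_)
    · rw [Matrix.mul_diagonal, Matrix.diagonal_mul, ← hw, ← weight, tr, Matrix.of_apply,
        Matrix.of_apply, Matrix.of_apply, ← Algebra.commutes, ← Algebra.smul_def,
        ← Algebra.smul_def, smul_mul_assoc, smul_mul_assoc, smul_comm]
    · by_cases hab : a = b
      · subst hab
        simp [smul_smul, hwm]
      · simp [hab]
  · have h3 := congrArg (weight s b • ·) (h2 b.rev a)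
    simp only [Finset.smul_sum, smul_ite, smul_zero] at h3
    rw [Matrix.mul_diagonal, Matrix.mul_apply, Finset.sum_mul, Matrix.smul_apply, Matrix.one_apply]
    refine (Finset.sum_congr rfl fun j _ => ?_).trans (h3.trans ?_)
    · rw [Matrix.mul_diagonal, ← hw, ← weight, tr, Matrix.of_apply,
        Matrix.of_apply, Matrix.of_apply, ← Algebra.commutes, ← Algebra.commutes,
        ← Algebra.smul_def, ← Algebra.smul_def, smul_mul_assoc]
    · by_cases hab : a = b
      · subst hab
        simp [smul_smul, mul_comm (weight s a), hwm]
      · have : b ≠ a := fun h => hab h.symm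
        simp [hab, this]

end Main

end QAffineBD

theorem mainTheorem9 {K : Type*} [Field K] [Algebra ℂ K] (s : K) (hs : Transcendental ℂ s)
    (N : ℕ) (hN : 3 ≤ N) :
    (∀ ε : QAffineBD.Sgn, ∃ z : PowerSeries (QAffineBD.UR s N),
      QAffineBD.lift (QAffineBD.UR s N) (QAffineBD.D s N)
          * QAffineBD.tr (QAffineBD.Lmat (QAffineBD.Rser s N) ε (QAffineBD.xi s N))
          * QAffineBD.lift (QAffineBD.UR s N) (QAffineBD.D s N)⁻¹
          * QAffineBD.Lmat (QAffineBD.Rser s N) ε 1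
        = z • (1 : Matrix (Fin N) (Fin N) (PowerSeries (QAffineBD.UR s N))) ∧
      QAffineBD.Lmat (QAffineBD.Rser s N) ε 1
          * QAffineBD.lift (QAffineBD.UR s N) (QAffineBD.D s N)
          * QAffineBD.tr (QAffineBD.Lmat (QAffineBD.Rser s N) ε (QAffineBD.xi s N))
          * QAffineBD.lift (QAffineBD.UR s N) (QAffineBD.D s N)⁻¹
        = z • (1 : Matrix (Fin N) (Fin N) (PowerSeries (QAffineBD.UR s N))) ∧
      ∀ m : ℕ, PowerSeries.coeff m z ∈ Subalgebra.center K (QAffineBD.UR s N)) ∧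
    (∀ ε : QAffineBD.Sgn, ∃ z : PowerSeries (QAffineBD.URbar s N),
      QAffineBD.lift (QAffineBD.URbar s N) (QAffineBD.D s N)
          * QAffineBD.tr (QAffineBD.Lmat (QAffineBD.Rbarser s N) ε (QAffineBD.xi s N))
          * QAffineBD.lift (QAffineBD.URbar s N) (QAffineBD.D s N)⁻¹
          * QAffineBD.Lmat (QAffineBD.Rbarser s N) ε 1
        = z • (1 : Matrix (Fin N) (Fin N) (PowerSeries (QAffineBD.URbar s N))) ∧
      QAffineBD.Lmat (QAffineBD.Rbarser s N) ε 1
          * QAffineBD.lift (QAffineBD.URbar s N) (QAffineBD.D s N)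
          * QAffineBD.tr (QAffineBD.Lmat (QAffineBD.Rbarser s N) ε (QAffineBD.xi s N))
          * QAffineBD.lift (QAffineBD.URbar s N) (QAffineBD.D s N)⁻¹
        = z • (1 : Matrix (Fin N) (Fin N) (PowerSeries (QAffineBD.URbar s N)))) := by
  open QAffineBD in
  have hpow := fun {n : ℤ} (hn : n ≠ 0) => zpow_ne_of_transcendental hs hn
  have hs0 : s ≠ 0 := by
    have := hpow one_ne_zero 0
    rwa [zpow_one, map_zero] at this
  have hξn : ∀ k : ℕ, xi s N ^ k = s ^ (2 * (2 - N) * k : ℤ) := fun k => by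
    rw [xi, q, ← zpow_natCast s 2, ← zpow_mul, ← zpow_natCast, ← zpow_mul]
    rfl
  have hne : ∀ k : ℕ, 0 < k → (2 * (2 - N) * k : ℤ) ≠ 0 := fun k hk =>
    mul_ne_zero (mul_ne_zero two_ne_zero (by omega)) (by omega)
  have hq : (q s)⁻¹ ^ 2 ≠ 1 := by
    have := hpow (n := -4) (by norm_num) 1
    rwa [map_one, show s ^ (-4 : ℤ) = (q s)⁻¹ ^ 2 by
      rw [q, zpow_neg, inv_pow, ← pow_mul, ← zpow_natCast s]; rfl] at this
  have hξ : xi s N ≠ 1 := by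
    have := hpow (hne 1 one_pos) 1
    rwa [← hξn, pow_one, map_one] at this
  have hξ' : ∀ k : ℕ, 0 < k → 1 + xi s N ^ k ≠ 0 := fun k hk h => by
    have := hpow (hne k hk) (-1)
    rw [← hξn, map_neg, map_one] at this
    exact this (eq_neg_of_add_eq_zero_right h)
  refine ⟨fun ε => ?_, fun ε => ?_⟩
  · obtain ⟨z, h1, h2, h3, h4⟩ := exists_scalar_of_rll hs0 hq hξ (by omega) (gen (Rser s N)) ε
      (rllLeft_eq_rllRight_of_smul (Rpoly s N) _ (inv_f_mul_f s) ε (rll_gen (Rser s N) ε))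
    refine ⟨z, h3, h4, fun m => Subalgebra.mem_center_iff.2 fun y => ?_⟩
    have hone : ∀ x : UR s N, Commute 1 x := Commute.one_left
    have hw : ∀ x : UR s N, Commute (qc (Rser s N) ^ 2) x := fun x =>
      (commute_qc (Rser s N) x).pow_left 2
    have hw' : ∀ x : UR s N, Commute (qcInv (Rser s N) ^ 2) x := fun x =>
      (commute_qcInv (Rser s N) x).pow_left 2
    have hN2 : 2 ≤ N := by omega
    refine (commute_of_generators (commute_qc _ _).symm (commute_qcInv _ _).symm
      (fun δ i j n => ?_) y).symm
    -- Equal signs use the plain relation with both twists 1, opposite signs the mixed one. For z^+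
    -- the series u belongs to the first tensor factor and for z^- to the second, which decides
    -- between the two fusion lemmas.
    cases ε <;> cases δ
    · exact commute_coeff_of_plus hs0 hN2 hξ' _ h1 hone hone (rll_gen _ _) m i j n
    · exact commute_coeff_of_plus hs0 hN2 hξ' _ h1 hw hw' (rll_mixed_gen _) m i j n
    · exact commute_coeff_of_minus hs0 hN2 hξ' _ h2 hw hw' (rll_mixed_gen _) m i j n
    · exact commute_coeff_of_minus hs0 hN2 hξ' _ h2 hone hone (rll_gen _ _) m i j n
  · obtain ⟨g, g', hg, hR⟩ := Rbarser_eq (N := N) hs0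
    have hrll := rll_gen (Rbarser s N) ε
    obtain ⟨z, -, -, h3, h4⟩ := exists_scalar_of_rll hs0 hq hξ (by omega) (gen (Rbarser s N)) ε
      (rllLeft_eq_rllRight_of_smul (Rpoly s N) _ hg ε (hR ▸ hrll))
    exact ⟨z, h3, h4⟩
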